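/- Let $p\ge 2$ be an even integer, $\beta>0$, $0<m<1$ and $0\le Q_1<Q_2<1$ (with the convention $Q^0=1$). For $N\ge1$ let $$H_N(\sigma,J)=-\sqrt{\frac{p!}{2N^{p-1}}}\sum_{1\le i_1<\dots<i_p\le N}J_{i_1\dots i_p}\sigma_{i_1}\cdots\sigma_{i_p},\qquad \sigma\in\{-1,1\}^N,$$ with independent standard Gaussian couplings $J$, and let $\alpha_N(\beta)=\frac1N\,\mathbb E\log\sum_\sigma e^{-\beta H_N(\sigma,J)}$ be the pressure. For $t,x_1,x_2\ge0$, with further independent standard Gaussian variables $J^1_i,J^2_i$ ($1\le i\le N$), put $$Z_2=\sum_\sigma B(\sigma),\qquad B(\sigma)=\exp\Big(\sqrt{\tfrac{t\,p!}{2N^{p-1}}}\sum_{i_1<\dots<i_p}J_{i_1\dots i_p}\sigma_{i_1}\cdots\sigma_{i_p}+\sum_{a=1}^2\sqrt{x_a}\,\big(\tfrac p2Q_a^{p-2}\big)^{1/4}\sum_iJ_i^a\sigma_i\Big).$$ Write $\mathbb E_0,\mathbb E_1,\mathbb E_2$ for the expectations over $J$, $J^1$, $J^2$, and set $Z_1=(\mathbb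 E_2Z_2^m)^{1/m}$, $f_2=Z_2^m/\mathbb E_2Z_2^m$, $w_2(\sigma)=B(\sigma)/Z_2$ and $w_1(\sigma)=\mathbb E_2\big(f_2\,w_2(\sigma)\big)$. For a function $F$ of two configurations let $\Omega_a(F)=\sum_{\sigma,\sigma'}F(\sigma,\sigma')w_a(\sigma)w_a(\sigma')$ and $$\langle F\rangle_1=\mathbb E_0\mathbb E_1\,\Omega_1(F),\qquad \langle F\rangle_2=\mathbb E_0\mathbb E_1\mathbb E_2\big(f_2\,\Omega_2(F)\big).$$ With the overlap $q_{\sigma\sigma'}=\frac1N\sum_i\sigma_i\sigma_i'$, the potential of the associated two-dimensional mechanical system is $$\begin{aligned}V_N(t;x_1,x_2)={}&\tfrac12m\Big[\langle q^p\rangle_1-Q_1^p+\tfrac p2\big(Q_1^p-\langle q\rangle_1^2Q_1^{p-2}\big)\Big]\\&+\tfrac12(1-m)\Big[\langle q^p\rangle_2-Q_2^p+\tfrac p2\big(Q_2^p-\langle q\rangle_2^2Q_2^{p-2}\big)\Big].\end{aligned}$$ Its free motion reaching $x_1=x_2=0$ at time $t=\beta^2$ is $x_a(t)=v_a\,(t-\beta^2)$,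 where $$v_1=-\big(\tfrac p2Q_1^{p-2}\big)^{1/2}Q_1,\qquad v_2=\big(\tfrac p2\big)^{1/2}\Big(\frac{Q_1^{p-2}}{Q_2^{(p-2)/2}}\,Q_1-Q_2^{(p-2)/2}\,Q_2\Big).$$ **Theorem (1-RSB free energy).** Assume that along this free motion the potential vanishes and the mean overlaps are $Q_1$ and $Q_2$ in the thermodynamic limit, that is, for every $t\in[0,\beta^2)$, at the point $(t;x_1(t),x_2(t))$, $$\lim_{N\to\infty}V_N=0,\qquad\lim_{N\to\infty}\langle q\rangle_1=Q_1,\qquad\lim_{N\to\infty}\langle q\rangle_2=Q_2 .$$ Let $d\gamma(z)=(2\pi)^{-1/2}e^{-z^2/2}dz$ and $$\theta(z_1,z_2)=\beta\big(\tfrac p2\big)^{1/2}z_1\,Q_1^{(p-1)/2}+\beta\big(\tfrac p2\big)^{1/2}z_2\,\sqrt{Q_2^{p-1}-Q_1^{p-1}} .$$ Then the pressure of the $p$-spin glass is the 1-RSB pressure: $$\begin{aligned}\lim_{N\to\infty}\alpha_N(\beta)={}&\log2+\frac1m\int d\gamma(z_1)\,\log\int d\gamma(z_2)\,\cosh^m\theta(z_1,z_2)\\&+\frac{\beta^2}4\Big[1+(p-1)\,m\,Q_1^p+(p-1)(1-m)\,Q_2^p-p\,Q_2^{p-1}\Big],\end{aligned}$$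 and $Q_1,Q_2$ satisfy the self-consistency equations $$Q_1=\int d\gamma(z_1)\left[\frac{\int d\gamma(z_2)\cosh^m\theta\,\tanh\theta}{\int d\gamma(z_2)\cosh^m\theta}\right]^2,\qquad Q_2=\int d\gamma(z_1)\,\frac{\int d\gamma(z_2)\cosh^m\theta\,\tanh^2\theta}{\int d\gamma(z_2)\cosh^m\theta}.$$ -/

import Mathlib

open MeasureTheory ProbabilityTheory Filter Topology

namespace PSpin

noncomputable section

/-! ### The `p`-spin glass -/

/-- Configurations of `N` Ising spins; `ℤˣ = {1, -1}`. -/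
abbrev Config (N : ℕ) : Type := Fin N → ℤˣ

/-- The `i`-th spin as a real number. -/
def spin {N : ℕ} (σ : Config N) (i : Fin N) : ℝ := ((σ i : ℤ) : ℝ)

/-- The `p`-tuples `i₁ < ⋯ < i_p` of sites, given as the `p`-element sets of sites. -/
abbrev Tuples (p N : ℕ) : Type := {I : Finset (Fin N) // I.card = p}

/-- The sum `∑_{i₁ < ⋯ < i_p} J_{i₁ ⋯ i_p} σ_{i₁} ⋯ σ_{i_p}`. -/
def couplingSum {p N : ℕ} (J : Tuples p N → ℝ) (σ : Config N) : ℝ :=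
  ∑ I : Tuples p N, J I * ∏ i ∈ I.1, spin σ i

/-- The Hamiltonian of the `p`-spin glass in zero external field. -/
def hamiltonian {p N : ℕ} (J : Tuples p N → ℝ) (σ : Config N) : ℝ :=
  -√((p.factorial : ℝ) / (2 * (N : ℝ) ^ (p - 1))) * couplingSum J σ

/-- The law of a family, indexed by the finite type `ι`, of independent standard Gaussian
variables. -/
def gaussianFamily (ι : Type) [Fintype ι] : Measure (ι → ℝ) :=
  Measure.pi fun _ => gaussianReal 0 1

/-- The partition function `Z_N(β, J)`. -/
def partitionFunction {p N : ℕ} (β : ℝ) (J : Tuples p N → ℝ) : ℝ :=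
  ∑ σ : Config N, Real.exp (-β * hamiltonian J σ)

/-- The quenched free energy density `f_N(β) = -(1 / (β N)) 𝔼 log Z_N(β, J)`. -/
def freeEnergy (p N : ℕ) (β : ℝ) : ℝ :=
  -(1 / (β * N)) *
    ∫ J, Real.log (partitionFunction β J) ∂(gaussianFamily (Tuples p N))

/-- The pressure `α_N(β) = -β f_N(β)`. -/
def pressure (p N : ℕ) (β : ℝ) : ℝ := -β * freeEnergy p N β

/-! ### The generalized partition function with one step of replica symmetry breaking

Here `m₁ = 0 < m₂ = m < 1 = m₃`. The couplings are `J`; the random fields of the two levels are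
`J₁` and `J₂`; the averages over `J`, `J₁`, `J₂` are `𝔼₀`, `𝔼₁`, `𝔼₂`. -/

/-- The strength `((p / 2) Q^(p - 2))^(1 / 4)` of the random field attached to `Q`. -/
def fieldStrength (p : ℕ) (Q : ℝ) : ℝ := ((p : ℝ) / 2 * Q ^ (p - 2)) ^ (1 / 4 : ℝ)

section Interpolation

variable {p N : ℕ} (m Q₁ Q₂ t x₁ x₂ : ℝ) (J : Tuples p N → ℝ) (J₁ J₂ : Fin N → ℝ)

/-- The generalized Boltzmann factor of a configuration. -/
def boltzmann (σ : Config N) : ℝ :=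
  Real.exp (√(t * p.factorial / (2 * (N : ℝ) ^ (p - 1))) * couplingSum J σ
    + √x₁ * fieldStrength p Q₁ * ∑ i, J₁ i * spin σ i
    + √x₂ * fieldStrength p Q₂ * ∑ i, J₂ i * spin σ i)

/-- The generalized partition function `Z₂ = Z̃_N(t; x₁, x₂)`. -/
def Z₂ : ℝ := ∑ σ : Config N, boltzmann Q₁ Q₂ t x₁ x₂ J J₁ J₂ σ

/-- The partition function of the previous level, `Z₁ = (𝔼₂ Z₂^m)^(1 / m)`. -/
def Z₁ : ℝ :=
  (∫ J₂, Z₂ Q₁ Q₂ t x₁ x₂ J J₁ J₂ ^ m ∂(gaussianFamily (Fin N))) ^ (1 / m)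

/-- The density `f₂ = Z₂^m / 𝔼₂ Z₂^m = Z₂^m / Z₁^m`; the first one is `f₁ = 1`, as `m₁ = 0`. -/
def f₂ : ℝ := Z₂ Q₁ Q₂ t x₁ x₂ J J₁ J₂ ^ m / Z₁ m Q₁ Q₂ t x₁ x₂ J J₁ ^ m

/-- The Gibbs weights of the state `ω₂ = ω̃`. -/
def weight₂ (σ : Config N) : ℝ :=
  boltzmann Q₁ Q₂ t x₁ x₂ J J₁ J₂ σ / Z₂ Q₁ Q₂ t x₁ x₂ J J₁ J₂

/-- The weights of the state `ω₁(·) = 𝔼₂ (f₂ ω̃(·))`. -/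
def weight₁ (σ : Config N) : ℝ :=
  ∫ J₂, f₂ m Q₁ Q₂ t x₁ x₂ J J₁ J₂ * weight₂ Q₁ Q₂ t x₁ x₂ J J₁ J₂ σ
    ∂(gaussianFamily (Fin N))

end Interpolation

/-- The state of two replicas: `Ω(F) = ∑_{σ, σ'} F(σ, σ') w(σ) w(σ')`. -/
def replicaState {N : ℕ} (w : Config N → ℝ) (F : Config N → Config N → ℝ) : ℝ :=
  ∑ σ : Config N, ∑ σ' : Config N, F σ σ' * (w σ * w σ')

/-- The overlap `q_{σσ'}` of two configurations. -/
def overlap {N : ℕ} (σ σ' : Config N) : ℝ := (1 / (N : ℝ)) * ∑ i, spin σ i * spin σ' i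

section Brackets

variable (p N : ℕ) (m Q₁ Q₂ t x₁ x₂ : ℝ)

/-- The average `⟨F⟩₁ = 𝔼₀ 𝔼₁ Ω₁(F)`. -/
def bracket₁ (F : Config N → Config N → ℝ) : ℝ :=
  ∫ J, ∫ J₁, replicaState (weight₁ m Q₁ Q₂ t x₁ x₂ J J₁) F
    ∂(gaussianFamily (Fin N)) ∂(gaussianFamily (Tuples p N))

/-- The average `⟨F⟩₂ = 𝔼₀ 𝔼₁ 𝔼₂ (f₂ Ω₂(F))`. -/
def bracket₂ (F : Config N → Config N → ℝ) : ℝ :=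
  ∫ J, ∫ J₁, ∫ J₂, f₂ m Q₁ Q₂ t x₁ x₂ J J₁ J₂ *
      replicaState (weight₂ Q₁ Q₂ t x₁ x₂ J J₁ J₂) F
    ∂(gaussianFamily (Fin N)) ∂(gaussianFamily (Fin N)) ∂(gaussianFamily (Tuples p N))

/-- The mean overlap `⟨q⟩₁`. -/
def meanOverlap₁ : ℝ := bracket₁ p N m Q₁ Q₂ t x₁ x₂ overlap

/-- The mean overlap `⟨q⟩₂`. -/
def meanOverlap₂ : ℝ := bracket₂ p N m Q₁ Q₂ t x₁ x₂ overlap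

/-! ### The mechanical analogy -/

/-- The potential `V_N(t; x₁, x₂)` of the mechanical problem. -/
def potential : ℝ :=
  1 / 2 * m *
      (bracket₁ p N m Q₁ Q₂ t x₁ x₂ (fun σ σ' => overlap σ σ' ^ p) - Q₁ ^ p
        + (p : ℝ) / 2 * (Q₁ ^ p - meanOverlap₁ p N m Q₁ Q₂ t x₁ x₂ ^ 2 * Q₁ ^ (p - 2)))
    + 1 / 2 * (1 - m) *
      (bracket₂ p N m Q₁ Q₂ t x₁ x₂ (fun σ σ' => overlap σ σ' ^ p) - Q₂ ^ p
        + (p : ℝ) / 2 * (Q₂ ^ p - meanOverlap₂ p N m Q₁ Q₂ t x₁ x₂ ^ 2 * Q₂ ^ (p - 2)))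

end Brackets

/-- The first velocity, `-((p / 2) Q₁^(p - 2))^(1 / 2) ⟨q⟩₁`, at `⟨q⟩₁ = Q₁`. -/
def velocity₁ (p : ℕ) (Q₁ : ℝ) : ℝ := -√((p : ℝ) / 2 * Q₁ ^ (p - 2)) * Q₁

/-- The second velocity,
`(p / 2)^(1 / 2) (Q₁^(p - 2) / Q₂^((p - 2) / 2) ⟨q⟩₁ - Q₂^((p - 2) / 2) ⟨q⟩₂)`,
at `⟨q⟩₁ = Q₁` and `⟨q⟩₂ = Q₂`. -/
def velocity₂ (p : ℕ) (Q₁ Q₂ : ℝ) : ℝ :=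
  √((p : ℝ) / 2) * (Q₁ ^ (p - 2) / √(Q₂ ^ (p - 2)) * Q₁ - √(Q₂ ^ (p - 2)) * Q₂)

/-- First coordinate of the free motion that reaches the origin at time `β²`. -/
def path₁ (p : ℕ) (β Q₁ t : ℝ) : ℝ := velocity₁ p Q₁ * (t - β ^ 2)

/-- Second coordinate of the free motion that reaches the origin at time `β²`. -/
def path₂ (p : ℕ) (β Q₁ Q₂ t : ℝ) : ℝ := velocity₂ p Q₁ Q₂ * (t - β ^ 2)

/-- The potential vanishes in the thermodynamic limit, and the mean overlaps are identified with
`Q₁` and `Q₂`, along the free motion from its starting point up to (and excluding) its arrival at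
the physical point `t = β²`, `x₁ = x₂ = 0`. -/
def VanishingPotential (p : ℕ) (β m Q₁ Q₂ : ℝ) : Prop :=
  ∀ t : ℝ, 0 ≤ t → t < β ^ 2 →
    Tendsto (fun N : ℕ =>
      meanOverlap₁ p N m Q₁ Q₂ t (path₁ p β Q₁ t) (path₂ p β Q₁ Q₂ t)) atTop (𝓝 Q₁) ∧
    Tendsto (fun N : ℕ =>
      meanOverlap₂ p N m Q₁ Q₂ t (path₁ p β Q₁ t) (path₂ p β Q₁ Q₂ t)) atTop (𝓝 Q₂) ∧
    Tendsto (fun N : ℕ =>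
      potential p N m Q₁ Q₂ t (path₁ p β Q₁ t) (path₂ p β Q₁ Q₂ t)) atTop (𝓝 0)

/-! ### One step of replica symmetry breaking -/

/-- `θ(z₁, z₂) = β (p/2)^(1/2) z₁ Q₁^((p-1)/2) + β (p/2)^(1/2) z₂ (Q₂^(p-1) - Q₁^(p-1))^(1/2)`. -/
def theta (p : ℕ) (β Q₁ Q₂ z₁ z₂ : ℝ) : ℝ :=
  β * √((p : ℝ) / 2) * z₁ * √(Q₁ ^ (p - 1))
    + β * √((p : ℝ) / 2) * z₂ * √(Q₂ ^ (p - 1) - Q₁ ^ (p - 1))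

/-- The 1-RSB pressure. -/
def rsbPressure (p : ℕ) (β m Q₁ Q₂ : ℝ) : ℝ :=
  Real.log 2
    + 1 / m * ∫ z₁, Real.log
        (∫ z₂, Real.cosh (theta p β Q₁ Q₂ z₁ z₂) ^ m ∂(gaussianReal 0 1)) ∂(gaussianReal 0 1)
    + β ^ 2 / 4 * (1 + ((p : ℝ) - 1) * m * Q₁ ^ p + ((p : ℝ) - 1) * (1 - m) * Q₂ ^ p
        - p * Q₂ ^ (p - 1))

/-- The right-hand side of the 1-RSB self-consistency equation for `Q₁`. -/
def selfConsistency₁ (p : ℕ) (β m Q₁ Q₂ : ℝ) : ℝ :=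
  ∫ z₁, ((∫ z₂, Real.cosh (theta p β Q₁ Q₂ z₁ z₂) ^ m * Real.tanh (theta p β Q₁ Q₂ z₁ z₂)
        ∂(gaussianReal 0 1)) /
      (∫ z₂, Real.cosh (theta p β Q₁ Q₂ z₁ z₂) ^ m ∂(gaussianReal 0 1))) ^ 2
    ∂(gaussianReal 0 1)

/-- The right-hand side of the 1-RSB self-consistency equation for `Q₂`. -/
def selfConsistency₂ (p : ℕ) (β m Q₁ Q₂ : ℝ) : ℝ :=
  ∫ z₁, (∫ z₂, Real.cosh (theta p β Q₁ Q₂ z₁ z₂) ^ m * Real.tanh (theta p β Q₁ Q₂ z₁ z₂) ^ 2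
        ∂(gaussianReal 0 1)) /
      (∫ z₂, Real.cosh (theta p β Q₁ Q₂ z₁ z₂) ^ m ∂(gaussianReal 0 1))
    ∂(gaussianReal 0 1)

end

end PSpin

/-!
The proof is Guerra's interpolation, read along the free motion. Let `𝔼₀ 𝔼₁ (1 / N) log Z₁` be the
generalized pressure at the point `(t; x₁(t), x₂(t))`. At `t = β ^ 2` the random fields vanish and it
is the pressure of the `p`-spin glass; at `t = 0` the couplings vanish, the spins are independent,
and it is an explicit one-body quantity (`interpolation_pi_div_two`, `interpolation_zero`). The
difference is the integral of the derivative along the motion.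

The derivative is computed for an abstract two-level system over a finite configuration space: the
energy is a linear combination of outer Gaussian variables `g` and inner Gaussian variables `k`, and
the free energy is `𝔼_g (1 / m) log 𝔼_k Z ^ m`. Differentiating the amplitudes and integrating by
parts, once in `k` and once in `g` (`integral_eval_mul_tilted`, `integral_eval_mul_tiltedMean`),
leaves only second moments of observables in two replicas, which share the outer noise
(`outerMoment`) or the whole noise (`innerMoment`); this is `hasDerivAt_twoLevelFreeEnergy`. For the
spin glass these moments are the averages `⟨·⟩₁` and `⟨·⟩₂` of products of spins.

Expanding the `p`-th power of the overlap over all `p`-tuples of sites and discarding the tuples with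
a repeated site, a fraction that tends to `0`, identifies the moments of the interaction with
`⟨q ^ p⟩₁` and `⟨q ^ p⟩₂` in the limit (`abs_sum_spinProduct_sub_le`). The vanishing of the potential
then says that `m ⟨q ^ p⟩₁ + (1 - m) ⟨q ^ p⟩₂` tends to `m Q₁ ^ p + (1 - m) Q₂ ^ p`, so the derivative
tends to a constant at every point of the motion (`tendsto_interpolationRate`); it is bounded
uniformly in `N`, and dominated convergence gives the pressure. The time is parametrized as
`t = (β sin θ) ^ 2`: the amplitudes, which are square roots of affine functions of `t`, become
multiples of `sin θ` and `cos θ` and are smooth up to both ends of the motion.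

The self-consistency equations are the hypothesis on the mean overlaps at `t = 0`, where these are
one-body averages that do not depend on `N`.
-/

namespace PSpin

/-! ### Gaussian integration by parts -/

instance instIsProbabilityMeasureGaussianFamily (ι : Type) [Fintype ι] :
    IsProbabilityMeasure (gaussianFamily ι) := by
  unfold gaussianFamily; infer_instance

theorem hasDerivAt_gaussianPDFReal_zero_one (x : ℝ) :
    HasDerivAt (gaussianPDFReal 0 1) (-x * gaussianPDFReal 0 1 x) x := by
  have h : HasDerivAt (fun y : ℝ => -(y - 0) ^ 2 / (2 * ((1 : NNReal) : ℝ))) (-x) x := by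
    refine ((((hasDerivAt_id' x).sub_const 0).fun_pow 2).fun_neg.div_const
      (2 * ((1 : NNReal) : ℝ))).congr_deriv ?_
    simp only [NNReal.coe_one]
    ring
  have h2 := (h.exp).const_mul ((√(2 * Real.pi * ((1 : NNReal) : ℝ)))⁻¹)
  rw [← gaussianPDFReal_def] at h2
  refine h2.congr_deriv ?_
  simp only [gaussianPDFReal_def]
  ring

theorem integrable_gaussianReal_iff (f : ℝ → ℝ) :
    Integrable f (gaussianReal 0 1) ↔ Integrable (fun x => gaussianPDFReal 0 1 x * f x) := by
  rw [gaussianReal_of_var_ne_zero 0 one_ne_zero, integrable_withDensity_iff_integrable_smul₀']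
  · simp [toReal_gaussianPDF]
  · exact (measurable_gaussianPDF 0 1).aemeasurable
  · exact Eventually.of_forall fun x => gaussianPDF_lt_top

/-- Integration by parts against the standard Gaussian measure on the line. -/
theorem integral_id_mul_gaussianReal {f f' : ℝ → ℝ} (hf : ∀ x, HasDerivAt f (f' x) x)
    (hi : Integrable f (gaussianReal 0 1)) (hi' : Integrable f' (gaussianReal 0 1))
    (hxi : Integrable (fun x => x * f x) (gaussianReal 0 1)) :
    ∫ x, x * f x ∂(gaussianReal 0 1) = ∫ x, f' x ∂(gaussianReal 0 1) := by
  rw [integrable_gaussianReal_iff] at hi hi' hxi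
  have := integral_mul_deriv_eq_deriv_mul_of_integrable
    (u := gaussianPDFReal 0 1) (u' := fun x => -x * gaussianPDFReal 0 1 x) (v := f) (v' := f')
    (fun x _ => hasDerivAt_gaussianPDFReal_zero_one x) (fun x _ => hf x) hi'
    (by convert hxi.neg using 1; ext x; simp; ring) hi
  rw [integral_gaussianReal_eq_integral_smul one_ne_zero,
    integral_gaussianReal_eq_integral_smul one_ne_zero]
  simp only [smul_eq_mul]
  rw [this, ← integral_neg]
  congr 1; ext x; ring

theorem integrable_exp_abs (C : ℝ) :
    Integrable (fun x : ℝ => Real.exp (C * |x|)) (gaussianReal 0 1) :=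
  integrable_exp_mul_abs (integrable_exp_mul_gaussianReal C) (integrable_exp_mul_gaussianReal (-C))

section Family

variable {ι : Type} [Fintype ι] [DecidableEq ι]

/-- Resampling one coordinate leaves the law of a Gaussian family unchanged. -/
theorem measurePreserving_update_gaussianFamily (i : ι) :
    MeasurePreserving (fun z : (ι → ℝ) × ℝ => Function.update z.1 i z.2)
      ((gaussianFamily ι).prod (gaussianReal 0 1)) (gaussianFamily ι) := by
  have hm : Measurable (fun z : (ι → ℝ) × ℝ => Function.update z.1 i z.2) := by
    refine measurable_pi_iff.2 fun j => ?_
    by_cases h : j = i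
    · subst h; simpa using measurable_snd
    · simp only [Function.update_of_ne h]
      exact (measurable_pi_apply j).comp measurable_fst
  refine ⟨hm, (Measure.pi_eq fun s hs => ?_).symm⟩
  rw [Measure.map_apply hm (MeasurableSet.univ_pi hs)]
  have : (fun z : (ι → ℝ) × ℝ => Function.update z.1 i z.2) ⁻¹' (Set.univ.pi s)
      = (Set.univ.pi (Function.update s i Set.univ)) ×ˢ (s i) := by
    ext ⟨k, x⟩
    simp only [Set.mem_preimage, Set.mem_pi, Set.mem_univ, true_imp_iff, Set.mem_prod]
    constructor
    · intro h
      refine ⟨fun j => ?_, by simpa using h i⟩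
      by_cases hj : j = i
      · subst hj; simp
      · simpa [Function.update_of_ne hj] using h j
    · rintro ⟨h, hx⟩ j
      by_cases hj : j = i
      · subst hj; simpa using hx
      · simpa [Function.update_of_ne hj] using h j
  rw [this, Measure.prod_prod, gaussianFamily, Measure.pi_pi,
    ← Finset.mul_prod_erase Finset.univ (fun j => (gaussianReal 0 1) (s j)) (Finset.mem_univ i),
    ← Finset.mul_prod_erase Finset.univ (fun j => (gaussianReal 0 1) (Function.update s i Set.univ j))
      (Finset.mem_univ i), mul_comm]
  simp only [Function.update_self, measure_univ, one_mul]
  congr 1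
  refine Finset.prod_congr rfl fun j hj => ?_
  rw [Function.update_of_ne (Finset.ne_of_mem_erase hj)]

/-- Integration by parts in one coordinate of a Gaussian family. -/
theorem integral_eval_mul_gaussianFamily (i : ι) {f f' : (ι → ℝ) → ℝ}
    (hf : ∀ k, HasDerivAt (fun x => f (Function.update k i x)) (f' k) (k i))
    (hi : Integrable f (gaussianFamily ι)) (hi' : Integrable f' (gaussianFamily ι))
    (hxi : Integrable (fun k => k i * f k) (gaussianFamily ι)) :
    ∫ k, k i * f k ∂(gaussianFamily ι) = ∫ k, f' k ∂(gaussianFamily ι) := by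
  have hmp := measurePreserving_update_gaussianFamily i
  -- integrate the coordinate `i` first
  have key : ∀ {g : (ι → ℝ) → ℝ}, Integrable g (gaussianFamily ι) →
      ∫ k, g k ∂(gaussianFamily ι)
        = ∫ k, ∫ x, g (Function.update k i x) ∂(gaussianReal 0 1) ∂(gaussianFamily ι) := by
    intro g hg
    rw [← hmp.map_eq] at hg
    conv_lhs => rw [← hmp.map_eq]
    rw [integral_map hmp.measurable.aemeasurable hg.1]
    exact integral_prod _ (hg.comp_aemeasurable hmp.measurable.aemeasurable)
  have sec : ∀ {g : (ι → ℝ) → ℝ}, Integrable g (gaussianFamily ι) →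
      ∀ᵐ k ∂(gaussianFamily ι),
        Integrable (fun x => g (Function.update k i x)) (gaussianReal 0 1) := by
    intro g hg
    rw [← hmp.map_eq] at hg
    exact (hg.comp_aemeasurable hmp.measurable.aemeasurable).prod_right_ae
  rw [key hxi, key hi']
  refine integral_congr_ae ?_
  filter_upwards [sec hi, sec hi', sec hxi] with k h1 h2 h3
  simp only [Function.update_self] at h3 ⊢
  refine integral_id_mul_gaussianReal (fun x => ?_) h1 h2 h3
  simpa using hf (Function.update k i x)

end Family

/-- These exponentials dominate the integrands of the inner averages. -/
theorem integrable_exp_sum_abs {ι : Type} [Fintype ι] (C : ℝ) :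
    Integrable (fun k : ι → ℝ => Real.exp (C * ∑ i, |k i|)) (gaussianFamily ι) := by
  have := Integrable.fintype_prod (ι := ι) (f := fun _ x => Real.exp (C * |x|))
    (μ := fun _ => gaussianReal 0 1) (fun _ => integrable_exp_abs C)
  simpa only [gaussianFamily, Finset.mul_sum, Real.exp_sum] using this

/-! ### Gibbs averages over a finite set -/

section Gibbs

variable {S : Type} [Fintype S]

/-- The partition function `∑_σ exp (e σ)`; the sign of the energy is absorbed into `e`. -/
noncomputable def gibbsZ (e : S → ℝ) : ℝ := ∑ σ, Real.exp (e σ)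

/-- The Gibbs average of the observable `X` with weights proportional to `exp (e σ)`. -/
noncomputable def gibbsAvg (e X : S → ℝ) : ℝ := (∑ σ, X σ * Real.exp (e σ)) / gibbsZ e

theorem gibbsZ_pos [Nonempty S] (e : S → ℝ) : 0 < gibbsZ e :=
  Finset.sum_pos (fun _ _ => Real.exp_pos _) Finset.univ_nonempty

theorem abs_gibbsAvg_le [Nonempty S] (e : S → ℝ) {X : S → ℝ} {C : ℝ} (hX : ∀ σ, |X σ| ≤ C) :
    |gibbsAvg e X| ≤ C := by
  rw [gibbsAvg, abs_div, abs_of_pos (gibbsZ_pos e), div_le_iff₀ (gibbsZ_pos e), gibbsZ,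
    Finset.mul_sum]
  refine (Finset.abs_sum_le_sum_abs _ _).trans (Finset.sum_le_sum fun σ _ => ?_)
  rw [abs_mul, Real.abs_exp]
  exact mul_le_mul_of_nonneg_right (hX σ) (Real.exp_pos _).le

theorem gibbsAvg_one [Nonempty S] (e : S → ℝ) : gibbsAvg e 1 = 1 := by
  simp only [gibbsAvg, Pi.one_apply, one_mul]
  exact div_self (gibbsZ_pos e).ne'

theorem gibbsAvg_add (e X Y : S → ℝ) : gibbsAvg e (X + Y) = gibbsAvg e X + gibbsAvg e Y := by
  simp only [gibbsAvg, Pi.add_apply, add_mul, Finset.sum_add_distrib, add_div]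

theorem gibbsAvg_linearCombination {ι : Type} [Fintype ι] (e : S → ℝ) (c : ι → ℝ)
    (X : ι → S → ℝ) :
    gibbsAvg e (fun σ => ∑ i, c i * X i σ) = ∑ i, c i * gibbsAvg e (X i) := by
  simp only [gibbsAvg, Finset.sum_mul, Finset.mul_sum, Finset.sum_div, mul_div_assoc, mul_assoc]
  exact Finset.sum_comm

theorem continuous_gibbsZ : Continuous (gibbsZ (S := S)) := by
  unfold gibbsZ; fun_prop

theorem continuous_gibbsAvg [Nonempty S] (X : S → ℝ) : Continuous fun e : S → ℝ => gibbsAvg e X := by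
  unfold gibbsAvg
  exact Continuous.div (by fun_prop) continuous_gibbsZ fun e => (gibbsZ_pos e).ne'

theorem continuous_gibbsZ_rpow [Nonempty S] (m : ℝ) : Continuous fun e : S → ℝ => gibbsZ e ^ m :=
  continuous_gibbsZ.rpow_const fun e => Or.inl (gibbsZ_pos e).ne'

theorem gibbsZ_rpow_pos [Nonempty S] (m : ℝ) (e : S → ℝ) : 0 < gibbsZ e ^ m :=
  Real.rpow_pos_of_pos (gibbsZ_pos e) m

theorem gibbsZ_rpow_le [Nonempty S] {m : ℝ} (hm₀ : 0 < m) (hm₁ : m < 1) {e : S → ℝ} {R : ℝ}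
    (hR : 0 ≤ R) (he : ∀ σ, |e σ| ≤ R) : gibbsZ e ^ m ≤ Fintype.card S * Real.exp R := by
  have hc : (1 : ℝ) ≤ Fintype.card S := by exact_mod_cast Fintype.card_pos
  have h1 : gibbsZ e ≤ Fintype.card S * Real.exp R := by
    rw [gibbsZ, ← nsmul_eq_mul, ← Finset.card_univ]
    exact Finset.sum_le_card_nsmul _ _ _ fun σ _ =>
      Real.exp_le_exp.2 ((le_abs_self _).trans (he σ))
  refine (Real.rpow_le_rpow (gibbsZ_pos e).le h1 hm₀.le).trans ?_
  refine (Real.rpow_le_rpow_of_exponent_le ?_ hm₁.le).trans (Real.rpow_one _).le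
  nlinarith [Real.one_le_exp hR]

theorem le_gibbsZ_rpow [Nonempty S] {m : ℝ} (hm₀ : 0 < m) (hm₁ : m < 1) {e : S → ℝ} {R : ℝ}
    (hR : 0 ≤ R) (he : ∀ σ, |e σ| ≤ R) : Real.exp (-R) ≤ gibbsZ e ^ m := by
  obtain ⟨σ⟩ := ‹Nonempty S›
  have h1 : Real.exp (-R) ≤ gibbsZ e :=
    (Real.exp_le_exp.2 (neg_le_of_abs_le (he σ))).trans
      (Finset.single_le_sum (f := fun σ => Real.exp (e σ)) (fun τ _ => (Real.exp_pos _).le)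
        (Finset.mem_univ σ))
  refine le_trans ?_ (Real.rpow_le_rpow (Real.exp_pos _).le h1 hm₀.le)
  rw [← Real.exp_mul]
  exact Real.exp_le_exp.2 (by nlinarith)

/-- Derivative of the unnormalised tilted average `Z ^ m ⟨X⟩` along a curve of energies. -/
theorem hasDerivAt_gibbsZ_rpow_mul_gibbsAvg [Nonempty S] (m : ℝ) (X : S → ℝ)
    {e : ℝ → S → ℝ} {e' : S → ℝ} {τ : ℝ} (he : ∀ σ, HasDerivAt (fun y => e y σ) (e' σ) τ) :
    HasDerivAt (fun y => gibbsZ (e y) ^ m * gibbsAvg (e y) X)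
      (gibbsZ (e τ) ^ m * (gibbsAvg (e τ) (X * e')
        - (1 - m) * (gibbsAvg (e τ) X * gibbsAvg (e τ) e'))) τ := by
  have hZ : HasDerivAt (fun y => gibbsZ (e y)) (∑ σ, e' σ * Real.exp (e τ σ)) τ := by
    unfold gibbsZ
    refine HasDerivAt.fun_sum fun σ _ => ?_
    simpa [mul_comm] using (he σ).exp
  have hX : HasDerivAt (fun y => ∑ σ, X σ * Real.exp (e y σ))
      (∑ σ, (X * e') σ * Real.exp (e τ σ)) τ := by
    refine HasDerivAt.fun_sum fun σ _ => ?_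
    refine ((he σ).exp.const_mul (X σ)).congr_deriv ?_
    simp only [Pi.mul_apply]; ring
  have hpos := gibbsZ_pos (e τ)
  refine ((hZ.rpow_const (p := m) (Or.inl hpos.ne')).fun_mul (hX.fun_div hZ hpos.ne')).congr_deriv ?_
  rw [Real.rpow_sub_one hpos.ne']
  simp only [gibbsAvg]
  field_simp
  ring

end Gibbs

/-! ### Random energies and the inner Gaussian average -/

section Inner

variable {S A B : Type} [Fintype A] [Fintype B]

/-- The random energy `σ ↦ ∑_a c_a g_a φ_a(σ)` with amplitudes `c` and noise `g`. -/
def randomEnergy (φ : A → S → ℝ) (c g : A → ℝ) (σ : S) : ℝ := ∑ a, c a * g a * φ a σ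

theorem abs_randomEnergy_le {φ : A → S → ℝ} (hφ : ∀ a σ, |φ a σ| ≤ 1) {c : A → ℝ} {K : ℝ}
    (hc : ∀ a, |c a| ≤ K) (g : A → ℝ) (σ : S) :
    |randomEnergy φ c g σ| ≤ K * ∑ a, |g a| := by
  rw [randomEnergy, Finset.mul_sum]
  refine (Finset.abs_sum_le_sum_abs _ _).trans (Finset.sum_le_sum fun a _ => ?_)
  rw [abs_mul, abs_mul]
  have h1 : |c a| * |g a| ≤ K * |g a| := mul_le_mul_of_nonneg_right (hc a) (abs_nonneg _)
  have h2 : |c a| * |g a| * |φ a σ| ≤ |c a| * |g a| * 1 :=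
    mul_le_mul_of_nonneg_left (hφ a σ) (by positivity)
  linarith

theorem abs_add_randomEnergy_le {ψ : B → S → ℝ} (hψ : ∀ b σ, |ψ b σ| ≤ 1) {d : B → ℝ}
    {e : S → ℝ} {M : ℝ} (he : ∀ σ, |e σ| ≤ M) (hd : ∀ b, |d b| ≤ M) (k : B → ℝ) (σ : S) :
    |(e + randomEnergy ψ d k) σ| ≤ M + M * ∑ b, |k b| :=
  (abs_add_le _ _).trans (add_le_add (he σ) (abs_randomEnergy_le hψ hd k σ))

theorem continuous_randomEnergy (φ : A → S → ℝ) (c : A → ℝ) :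
    Continuous fun g : A → ℝ => randomEnergy φ c g := by
  unfold randomEnergy
  exact continuous_pi fun σ => by fun_prop

variable [Fintype S]

/-- The unnormalised inner average `𝔼_k (Z ^ m F)`, where `Z` and `F` are evaluated at the energy
`e + ∑_b d_b k_b ψ_b`. The observable `F` is a function of the whole energy, as a Gibbs average is. -/
noncomputable def tiltedIntegral (m : ℝ) (ψ : B → S → ℝ) (d : B → ℝ) (F : (S → ℝ) → ℝ)
    (e : S → ℝ) : ℝ :=
  ∫ k, gibbsZ (e + randomEnergy ψ d k) ^ m * F (e + randomEnergy ψ d k) ∂(gaussianFamily B)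

/-- The inner average `𝔼_k (Z ^ m F) / 𝔼_k Z ^ m`: the expectation of `F` under the law of `k`
reweighted by `Z ^ m`. -/
noncomputable def tiltedMean (m : ℝ) (ψ : B → S → ℝ) (d : B → ℝ) (F : (S → ℝ) → ℝ)
    (e : S → ℝ) : ℝ :=
  tiltedIntegral m ψ d F e / tiltedIntegral m ψ d (fun _ => 1) e

theorem integrable_of_le_exp_sum_abs {f : (B → ℝ) → ℝ}
    (hf : AEStronglyMeasurable f (gaussianFamily B)) {C K : ℝ}
    (h : ∀ k, |f k| ≤ C * Real.exp (K * ∑ b, |k b|)) : Integrable f (gaussianFamily B) :=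
  ((integrable_exp_sum_abs K).const_mul C).mono' hf (Eventually.of_forall h)

theorem exists_bound_of_finite {ι : Type} [Finite ι] (f : ι → ℝ) : ∃ M, 0 ≤ M ∧ ∀ i, |f i| ≤ M := by
  have := Fintype.ofFinite ι
  exact ⟨∑ i, |f i|, Finset.sum_nonneg fun _ _ => abs_nonneg _,
    fun i => Finset.single_le_sum (f := fun i => |f i|) (fun _ _ => abs_nonneg _) (Finset.mem_univ i)⟩

variable [Nonempty S] {m : ℝ} {ψ : B → S → ℝ}

theorem continuous_tilted_integrand {F : (S → ℝ) → ℝ} (hF : Continuous F) (e : S → ℝ) (d : B → ℝ) :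
    Continuous fun k : B → ℝ =>
      gibbsZ (e + randomEnergy ψ d k) ^ m * F (e + randomEnergy ψ d k) := by
  have h : Continuous fun k : B → ℝ => e + randomEnergy ψ d k :=
    continuous_const.add (continuous_randomEnergy ψ d)
  exact ((continuous_gibbsZ_rpow m).comp h).mul (hF.comp h)

theorem gibbsZ_rpow_add_randomEnergy_le (hm₀ : 0 < m) (hm₁ : m < 1) (hψ : ∀ b σ, |ψ b σ| ≤ 1)
    {d : B → ℝ} {e : S → ℝ} {M : ℝ} (hM : 0 ≤ M) (he : ∀ σ, |e σ| ≤ M) (hd : ∀ b, |d b| ≤ M)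
    (k : B → ℝ) :
    gibbsZ (e + randomEnergy ψ d k) ^ m ≤ Fintype.card S * Real.exp (M + M * ∑ b, |k b|) :=
  gibbsZ_rpow_le hm₀ hm₁ (by positivity) (abs_add_randomEnergy_le hψ he hd k)

theorem integrable_tilted (hm₀ : 0 < m) (hm₁ : m < 1) (hψ : ∀ b σ, |ψ b σ| ≤ 1)
    (d : B → ℝ) (e : S → ℝ) {F : (S → ℝ) → ℝ} (hF : Continuous F) {C : ℝ} (hC : ∀ v, |F v| ≤ C) :
    Integrable (fun k : B → ℝ => gibbsZ (e + randomEnergy ψ d k) ^ m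
      * F (e + randomEnergy ψ d k)) (gaussianFamily B) := by
  obtain ⟨M₁, hM₁, he⟩ := exists_bound_of_finite e
  obtain ⟨M₂, hM₂, hd⟩ := exists_bound_of_finite d
  refine integrable_of_le_exp_sum_abs (continuous_tilted_integrand hF e d).aestronglyMeasurable
    (C := Fintype.card S * Real.exp (M₁ + M₂) * C) (K := M₁ + M₂) fun k => ?_
  have h := gibbsZ_rpow_add_randomEnergy_le hm₀ hm₁ hψ (M := M₁ + M₂) (by positivity)
    (fun σ => (he σ).trans (by linarith)) (fun b => (hd b).trans (by linarith)) k
  rw [abs_mul, abs_of_pos (gibbsZ_rpow_pos m _)]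
  refine (mul_le_mul h (hC _) (abs_nonneg _) (by positivity)).trans_eq ?_
  rw [Real.exp_add (M₁ + M₂)]
  ring

theorem integrable_eval_mul_tilted (hm₀ : 0 < m) (hm₁ : m < 1) (hψ : ∀ b σ, |ψ b σ| ≤ 1)
    (d : B → ℝ) (e : S → ℝ) {F : (S → ℝ) → ℝ} (hF : Continuous F) {C : ℝ} (hC : ∀ v, |F v| ≤ C)
    (b : B) :
    Integrable (fun k : B → ℝ => k b * (gibbsZ (e + randomEnergy ψ d k) ^ m
      * F (e + randomEnergy ψ d k))) (gaussianFamily B) := by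
  obtain ⟨M₁, hM₁, he⟩ := exists_bound_of_finite e
  obtain ⟨M₂, hM₂, hd⟩ := exists_bound_of_finite d
  refine integrable_of_le_exp_sum_abs
    ((continuous_apply b).mul (continuous_tilted_integrand hF e d)).aestronglyMeasurable
    (C := Fintype.card S * Real.exp (M₁ + M₂) * C) (K := M₁ + M₂ + 1) fun k => ?_
  have h := gibbsZ_rpow_add_randomEnergy_le hm₀ hm₁ hψ (M := M₁ + M₂) (by positivity)
    (fun σ => (he σ).trans (by linarith)) (fun b => (hd b).trans (by linarith)) k
  have hk : |k b| ≤ Real.exp (∑ b, |k b|) := by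
    have h1 : |k b| ≤ ∑ b, |k b| :=
      Finset.single_le_sum (f := fun b => |k b|) (fun _ _ => abs_nonneg _) (Finset.mem_univ b)
    linarith [Real.add_one_le_exp (∑ b, |k b|)]
  rw [abs_mul, abs_mul, abs_of_pos (gibbsZ_rpow_pos m _)]
  refine (mul_le_mul hk (mul_le_mul h (hC _) (abs_nonneg _) (by positivity)) ?_
    (Real.exp_pos _).le).trans_eq ?_
  · exact mul_nonneg (gibbsZ_rpow_pos m _).le (abs_nonneg _)
  · rw [Real.exp_add (M₁ + M₂), add_mul (M₁ + M₂) 1, Real.exp_add ((M₁ + M₂) * _), one_mul]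
    ring

theorem tiltedIntegral_one_pos (hm₀ : 0 < m) (hm₁ : m < 1) (hψ : ∀ b σ, |ψ b σ| ≤ 1)
    (d : B → ℝ) (e : S → ℝ) : 0 < tiltedIntegral m ψ d (fun _ => 1) e := by
  refine (integral_pos_iff_support_of_nonneg
    (fun k => ?_) (integrable_tilted hm₀ hm₁ hψ d e continuous_const (C := 1) (by simp))).2 ?_
  · simpa using (gibbsZ_rpow_pos m _).le
  · have : (Function.support fun k : B → ℝ => gibbsZ (e + randomEnergy ψ d k) ^ m * (1 : ℝ))
        = Set.univ := by
      ext k; simpa using (gibbsZ_rpow_pos m (e + randomEnergy ψ d k)).ne'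
    rw [this]; simp

theorem abs_tiltedMean_le (hm₀ : 0 < m) (hm₁ : m < 1) (hψ : ∀ b σ, |ψ b σ| ≤ 1)
    (d : B → ℝ) (e : S → ℝ) {F : (S → ℝ) → ℝ} (hF : Continuous F) {C : ℝ} (hC : ∀ v, |F v| ≤ C) :
    |tiltedMean m ψ d F e| ≤ C := by
  have hpos := tiltedIntegral_one_pos hm₀ hm₁ hψ d e
  rw [tiltedMean, abs_div, abs_of_pos hpos, div_le_iff₀ hpos, tiltedIntegral, tiltedIntegral,
    ← integral_const_mul]
  refine (abs_integral_le_integral_abs).trans (integral_mono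
    (integrable_tilted hm₀ hm₁ hψ d e hF hC).abs
    ((integrable_tilted hm₀ hm₁ hψ d e continuous_const (C := 1) (by simp)).const_mul C)
    fun k => ?_)
  simp only [abs_mul, abs_of_pos (gibbsZ_rpow_pos m (e + randomEnergy ψ d k)), mul_one]
  rw [mul_comm]
  exact mul_le_mul_of_nonneg_right (hC _) (gibbsZ_rpow_pos m _).le

/-- Measurability of the inner average as a function of the outer noise. -/
theorem stronglyMeasurable_tiltedIntegral (φ : A → S → ℝ) (c : A → ℝ) (d : B → ℝ)
    {F : (S → ℝ) → ℝ} (hF : Continuous F) :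
    StronglyMeasurable fun g : A → ℝ => tiltedIntegral m ψ d F (randomEnergy φ c g) := by
  unfold tiltedIntegral
  refine StronglyMeasurable.integral_prod_right (f := fun g k =>
    gibbsZ (randomEnergy φ c g + randomEnergy ψ d k) ^ m
      * F (randomEnergy φ c g + randomEnergy ψ d k)) ?_
  have h : Continuous fun z : (A → ℝ) × (B → ℝ) => randomEnergy φ c z.1 + randomEnergy ψ d z.2 :=
    ((continuous_randomEnergy φ c).comp continuous_fst).add
      ((continuous_randomEnergy ψ d).comp continuous_snd)
  exact (((continuous_gibbsZ_rpow m).comp h).mul (hF.comp h)).stronglyMeasurable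

theorem stronglyMeasurable_tiltedMean (φ : A → S → ℝ) (c : A → ℝ) (d : B → ℝ)
    {F : (S → ℝ) → ℝ} (hF : Continuous F) :
    StronglyMeasurable fun g : A → ℝ => tiltedMean m ψ d F (randomEnergy φ c g) :=
  ((stronglyMeasurable_tiltedIntegral φ c d hF).measurable.div
    (stronglyMeasurable_tiltedIntegral φ c d continuous_const).measurable).stronglyMeasurable

theorem integrable_tiltedMean {φ : A → S → ℝ} (hm₀ : 0 < m) (hm₁ : m < 1)
    (hψ : ∀ b σ, |ψ b σ| ≤ 1) (c : A → ℝ) (d : B → ℝ)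
    {F : (S → ℝ) → ℝ} (hF : Continuous F) {C : ℝ} (hC : ∀ v, |F v| ≤ C) :
    Integrable (fun g : A → ℝ => tiltedMean m ψ d F (randomEnergy φ c g)) (gaussianFamily A) :=
  Integrable.of_bound (stronglyMeasurable_tiltedMean φ c d hF).aestronglyMeasurable C
    (Eventually.of_forall fun _ => abs_tiltedMean_le hm₀ hm₁ hψ d _ hF hC)

/-- Differentiation of `𝔼_k (Z ^ m ⟨X⟩)` along a curve of energies and amplitudes. -/
theorem hasDerivAt_tiltedIntegral (hm₀ : 0 < m) (hm₁ : m < 1) (hψ : ∀ b σ, |ψ b σ| ≤ 1)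
    {X : S → ℝ} (hX : ∀ σ, |X σ| ≤ 1) {e e' : ℝ → S → ℝ} {d d' : ℝ → B → ℝ} {τ M : ℝ}
    (he : ∀ y ∈ Metric.ball τ 1, ∀ σ, HasDerivAt (fun y => e y σ) (e' y σ) y)
    (hd : ∀ y ∈ Metric.ball τ 1, ∀ b, HasDerivAt (fun y => d y b) (d' y b) y)
    (heM : ∀ y ∈ Metric.ball τ 1, ∀ σ, |e y σ| ≤ M)
    (heM' : ∀ y ∈ Metric.ball τ 1, ∀ σ, |e' y σ| ≤ M)
    (hdM : ∀ y ∈ Metric.ball τ 1, ∀ b, |d y b| ≤ M)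
    (hdM' : ∀ y ∈ Metric.ball τ 1, ∀ b, |d' y b| ≤ M) :
    HasDerivAt (fun y => tiltedIntegral m ψ (d y) (fun v => gibbsAvg v X) (e y))
      (∫ k, gibbsZ (e τ + randomEnergy ψ (d τ) k) ^ m
        * (gibbsAvg (e τ + randomEnergy ψ (d τ) k) (X * (e' τ + randomEnergy ψ (d' τ) k))
          - (1 - m) * (gibbsAvg (e τ + randomEnergy ψ (d τ) k) X
            * gibbsAvg (e τ + randomEnergy ψ (d τ) k) (e' τ + randomEnergy ψ (d' τ) k)))
        ∂(gaussianFamily B)) τ := by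
  have hτ : τ ∈ Metric.ball τ 1 := Metric.mem_ball_self one_pos
  have hM : 0 ≤ M := by
    obtain ⟨σ⟩ := ‹Nonempty S›
    exact (abs_nonneg _).trans (heM τ hτ σ)
  have hXc := continuous_gibbsAvg X
  have hXb : ∀ v, |gibbsAvg v X| ≤ 1 := fun v => abs_gibbsAvg_le v hX
  refine (hasDerivAt_integral_of_dominated_loc_of_deriv_le (s := Metric.ball τ 1)
    (bound := fun k => 2 * Fintype.card S * Real.exp (2 * M) * Real.exp (2 * M * ∑ b, |k b|))
    (F := fun y k => gibbsZ (e y + randomEnergy ψ (d y) k) ^ m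
      * gibbsAvg (e y + randomEnergy ψ (d y) k) X)
    (F' := fun y k => gibbsZ (e y + randomEnergy ψ (d y) k) ^ m
        * (gibbsAvg (e y + randomEnergy ψ (d y) k) (X * (e' y + randomEnergy ψ (d' y) k))
          - (1 - m) * (gibbsAvg (e y + randomEnergy ψ (d y) k) X
            * gibbsAvg (e y + randomEnergy ψ (d y) k) (e' y + randomEnergy ψ (d' y) k))))
    (Metric.ball_mem_nhds τ one_pos)
    (Eventually.of_forall fun y => (continuous_tilted_integrand hXc _ _).aestronglyMeasurable)
    (integrable_tilted hm₀ hm₁ hψ _ _ hXc hXb) ?_ ?_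
    ((integrable_exp_sum_abs (2 * M)).const_mul _) ?_).2
  · have h : Continuous fun k : B → ℝ => e τ + randomEnergy ψ (d τ) k :=
      continuous_const.add (continuous_randomEnergy ψ _)
    have h' : Continuous fun k : B → ℝ => e' τ + randomEnergy ψ (d' τ) k :=
      continuous_const.add (continuous_randomEnergy ψ _)
    have key : ∀ Y : (B → ℝ) → S → ℝ, Continuous Y →
        Continuous fun k => gibbsAvg (e τ + randomEnergy ψ (d τ) k) (Y k) := by
      intro Y hY
      unfold gibbsAvg
      refine Continuous.div ?_ (continuous_gibbsZ.comp h) fun k => (gibbsZ_pos _).ne'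
      refine continuous_finsetSum _ fun σ _ => ?_
      exact ((continuous_apply σ).comp hY).mul
        (Real.continuous_exp.comp ((continuous_apply σ).comp h))
    exact (((continuous_gibbsZ_rpow m).comp h).mul ((key _ (continuous_const.mul h')).sub
      (continuous_const.mul ((hXc.comp h).mul (key _ h'))))).aestronglyMeasurable
  · refine Eventually.of_forall fun k y hy => ?_
    set v := e y + randomEnergy ψ (d y) k
    set v' := e' y + randomEnergy ψ (d' y) k
    set R := M + M * ∑ b, |k b| with hR
    have hR0 : 0 ≤ R := by positivity
    have hZ : gibbsZ v ^ m ≤ Fintype.card S * Real.exp R :=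
      gibbsZ_rpow_add_randomEnergy_le hm₀ hm₁ hψ hM (heM y hy) (hdM y hy) k
    have hv' : ∀ σ, |v' σ| ≤ R := abs_add_randomEnergy_le hψ (heM' y hy) (hdM' y hy) k
    have h1 : |gibbsAvg v (X * v')| ≤ R := abs_gibbsAvg_le v fun σ => by
      rw [Pi.mul_apply, abs_mul]
      exact (mul_le_mul (hX σ) (hv' σ) (abs_nonneg _) one_pos.le).trans_eq (one_mul R)
    have h2 : |(1 - m) * (gibbsAvg v X * gibbsAvg v v')| ≤ R := by
      rw [abs_mul, abs_mul, abs_of_pos (by linarith : 0 < 1 - m)]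
      have h3 : |gibbsAvg v X| * |gibbsAvg v v'| ≤ 1 * R :=
        mul_le_mul (hXb v) (abs_gibbsAvg_le v hv') (abs_nonneg _) one_pos.le
      nlinarith [abs_nonneg (gibbsAvg v X), abs_nonneg (gibbsAvg v v'),
        mul_nonneg (abs_nonneg (gibbsAvg v X)) (abs_nonneg (gibbsAvg v v'))]
    -- the factor linear in the noise is absorbed into a second exponential
    have h4 : |gibbsAvg v (X * v') - (1 - m) * (gibbsAvg v X * gibbsAvg v v')|
        ≤ 2 * Real.exp R :=
      (abs_sub _ _).trans (by linarith [Real.add_one_le_exp R])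
    rw [Real.norm_eq_abs, abs_mul, abs_of_pos (gibbsZ_rpow_pos m v)]
    refine (mul_le_mul hZ h4 (abs_nonneg _) (by positivity)).trans_eq ?_
    have : Real.exp (2 * M) * Real.exp (2 * M * ∑ b, |k b|) = Real.exp R * Real.exp R := by
      rw [← Real.exp_add, ← Real.exp_add, hR]; congr 1; ring
    linear_combination -(2 * (Fintype.card S : ℝ)) * this
  · refine Eventually.of_forall fun k y hy => ?_
    refine hasDerivAt_gibbsZ_rpow_mul_gibbsAvg m X (e := fun y => e y + randomEnergy ψ (d y) k)
      (e' := e' y + randomEnergy ψ (d' y) k) fun σ => ?_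
    refine (he y hy σ).add ?_
    unfold randomEnergy
    exact HasDerivAt.fun_sum fun b _ => ((hd y hy b).mul_const _).mul_const _

end Inner

/-! ### Derivative of the two-level free energy -/

section TwoLevel

variable {S A B : Type} [Fintype A] [Fintype B] {m : ℝ} {ψ : B → S → ℝ} {φ : A → S → ℝ}

/-- The energy is affine in each noise variable. -/
theorem randomEnergy_update [DecidableEq A] (c g : A → ℝ) (a : A) (x : ℝ) :
    randomEnergy φ c (Function.update g a x)
      = randomEnergy φ c (Function.update g a 0) + x • (c a • φ a) := by
  ext σ
  simp only [randomEnergy, Pi.add_apply, Pi.smul_apply, smul_eq_mul]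
  rw [← Finset.add_sum_erase _ _ (Finset.mem_univ a),
    ← Finset.add_sum_erase _ (fun i => c i * Function.update g a 0 i * φ i σ) (Finset.mem_univ a)]
  have : ∀ i ∈ Finset.univ.erase a, c i * Function.update g a x i * φ i σ
      = c i * Function.update g a 0 i * φ i σ := by
    intro i hi
    rw [Function.update_of_ne (Finset.ne_of_mem_erase hi),
      Function.update_of_ne (Finset.ne_of_mem_erase hi)]
  rw [Finset.sum_congr rfl this]
  simp only [Function.update_self]
  ring

variable [Fintype S]

theorem gibbsAvg_smul (v : S → ℝ) (c : ℝ) (X : S → ℝ) : gibbsAvg v (c • X) = c * gibbsAvg v X := by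
  simp only [gibbsAvg, Pi.smul_apply, smul_eq_mul, mul_assoc, ← Finset.mul_sum, mul_div_assoc]

variable [Nonempty S]

theorem abs_le_one_of_sq_eq_one {x : ℝ} (h : x ^ 2 = 1) : |x| ≤ 1 := by
  rw [← sq_le_one_iff_abs_le_one]; exact h.le

/-- The case of a segment of energies and fixed amplitudes. -/
theorem hasDerivAt_tiltedIntegral_affine (hm₀ : 0 < m) (hm₁ : m < 1) (hψ : ∀ b σ, |ψ b σ| ≤ 1)
    {X : S → ℝ} (hX : ∀ σ, |X σ| ≤ 1) (d : B → ℝ) (e f : S → ℝ) (x : ℝ) :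
    HasDerivAt (fun y : ℝ => tiltedIntegral m ψ d (fun v => gibbsAvg v X) (e + y • f))
      (tiltedIntegral m ψ d (fun v => gibbsAvg v (X * f) - (1 - m) * (gibbsAvg v X * gibbsAvg v f))
        (e + x • f)) x := by
  obtain ⟨M₁, hM₁, he⟩ := exists_bound_of_finite e
  obtain ⟨M₂, hM₂, hf⟩ := exists_bound_of_finite f
  obtain ⟨M₃, hM₃, hd⟩ := exists_bound_of_finite d
  have hx : 0 ≤ |x| := abs_nonneg x
  have hxM : 0 ≤ |x| * M₂ := by positivity
  have h := hasDerivAt_tiltedIntegral hm₀ hm₁ hψ hX (e := fun y => e + y • f) (e' := fun _ => f)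
    (d := fun _ => d) (d' := fun _ _ => 0) (τ := x) (M := M₁ + (|x| + 1) * M₂ + M₃)
    (fun y _ σ => by
      simpa using ((hasDerivAt_id y).mul_const (f σ)).const_add (e σ))
    (fun y _ b => hasDerivAt_const y (d b))
    (fun y hy σ => by
      have hy' : |y| ≤ |x| + 1 := by
        have h1 := abs_sub_abs_le_abs_sub y x
        have h2 : |y - x| < 1 := hy
        linarith
      have h1 : |y * f σ| ≤ (|x| + 1) * M₂ := by
        rw [abs_mul]; exact mul_le_mul hy' (hf σ) (abs_nonneg _) (by positivity)
      calc |(e + y • f) σ| ≤ |e σ| + |y * f σ| := abs_add_le _ _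
        _ ≤ _ := by linarith [he σ])
    (fun y _ σ => by nlinarith [hf σ])
    (fun y _ b => by nlinarith [hd b])
    (fun y _ b => by rw [abs_zero]; positivity)
  have h0 : ∀ k : B → ℝ, randomEnergy ψ (fun _ => 0) k = 0 := fun k => by
    ext σ; simp [randomEnergy]
  simp only [h0, add_zero] at h
  exact h

/-- Inner integration by parts. The observable squares to `1`, so its derivative in `k_b` involves
only the square of its Gibbs average. -/
theorem integral_eval_mul_tilted (hm₀ : 0 < m) (hm₁ : m < 1) (hψ : ∀ b σ, ψ b σ ^ 2 = 1)
    (d : B → ℝ) (e : S → ℝ) (b : B) :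
    ∫ k, k b * (gibbsZ (e + randomEnergy ψ d k) ^ m
        * gibbsAvg (e + randomEnergy ψ d k) (ψ b)) ∂(gaussianFamily B)
      = d b * tiltedIntegral m ψ d (fun v => 1 - (1 - m) * gibbsAvg v (ψ b) ^ 2) e := by
  classical
  have hψ1 : ∀ b σ, |ψ b σ| ≤ 1 := fun b σ => abs_le_one_of_sq_eq_one (hψ b σ)
  have hc : Continuous fun v : S → ℝ => gibbsAvg v (ψ b) := continuous_gibbsAvg _
  have hb : ∀ v : S → ℝ, |gibbsAvg v (ψ b)| ≤ 1 := fun v => abs_gibbsAvg_le v (hψ1 b)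
  have hc2 : Continuous fun v : S → ℝ => 1 - (1 - m) * gibbsAvg v (ψ b) ^ 2 := by fun_prop
  have hb2 : ∀ v : S → ℝ, |1 - (1 - m) * gibbsAvg v (ψ b) ^ 2| ≤ 1 := fun v => by
    have h := (sq_le_one_iff_abs_le_one _).2 (hb v)
    rw [abs_le]
    constructor <;> nlinarith [sq_nonneg (gibbsAvg v (ψ b))]
  rw [integral_eval_mul_gaussianFamily b
    (f' := fun k => d b * (gibbsZ (e + randomEnergy ψ d k) ^ m
      * (1 - (1 - m) * gibbsAvg (e + randomEnergy ψ d k) (ψ b) ^ 2))) ?_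
    (integrable_tilted hm₀ hm₁ hψ1 d e hc hb)
    ((integrable_tilted hm₀ hm₁ hψ1 d e hc2 hb2).const_mul _)
    (integrable_eval_mul_tilted hm₀ hm₁ hψ1 d e hc hb b), integral_const_mul]
  · rfl
  · intro k
    have := hasDerivAt_gibbsZ_rpow_mul_gibbsAvg m (ψ b)
      (e := fun x => e + randomEnergy ψ d (Function.update k b x)) (e' := d b • ψ b) (τ := k b)
      (fun σ => by
        have hx : (fun x => (e + randomEnergy ψ d (Function.update k b x)) σ)
            = fun x => (e + randomEnergy ψ d (Function.update k b 0)) σ + x * (d b * ψ b σ) := by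
          funext x
          rw [randomEnergy_update]
          simp [add_assoc]
        rw [hx]
        simpa using ((hasDerivAt_id (k b)).mul_const (d b * ψ b σ)).const_add
          ((e + randomEnergy ψ d (Function.update k b 0)) σ))
    refine this.congr_deriv ?_
    have h1 : ψ b * d b • ψ b = d b • (1 : S → ℝ) := by
      ext σ
      simp only [Pi.mul_apply, Pi.smul_apply, smul_eq_mul, Pi.one_apply]
      linear_combination d b * hψ b σ
    simp only [Function.update_eq_self, h1, gibbsAvg_smul, gibbsAvg_one]
    ring

theorem tiltedMean_sum (hm₀ : 0 < m) (hm₁ : m < 1) (hψ : ∀ b σ, |ψ b σ| ≤ 1)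
    (d : B → ℝ) (e : S → ℝ) {ι : Type} [Fintype ι] (c : ι → ℝ) {F : ι → (S → ℝ) → ℝ}
    (hF : ∀ i, Continuous (F i)) {C : ℝ} (hC : ∀ i v, |F i v| ≤ C) :
    tiltedMean m ψ d (fun v => ∑ i, c i * F i v) e = ∑ i, c i * tiltedMean m ψ d (F i) e := by
  simp only [tiltedMean, mul_div_assoc', ← Finset.sum_div]
  congr 1
  simp only [tiltedIntegral, Finset.mul_sum, ← integral_const_mul]
  rw [← integral_finsetSum _ fun i _ =>
    (integrable_tilted hm₀ hm₁ hψ d e (hF i) (hC i)).const_mul (c i)]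
  congr 1; ext k
  refine Finset.sum_congr rfl fun i _ => ?_
  ring

/-- Derivative of `(1 / m) log 𝔼_k Z ^ m` along a curve of energies and amplitudes. The inner noise
has been integrated by parts, so that what multiplies the amplitudes is bounded. -/
theorem hasDerivAt_log_tiltedIntegral (hm₀ : 0 < m) (hm₁ : m < 1) (hψ : ∀ b σ, ψ b σ ^ 2 = 1)
    {e e' : ℝ → S → ℝ} {d d' : ℝ → B → ℝ} {τ M : ℝ}
    (he : ∀ y ∈ Metric.ball τ 1, ∀ σ, HasDerivAt (fun y => e y σ) (e' y σ) y)
    (hd : ∀ y ∈ Metric.ball τ 1, ∀ b, HasDerivAt (fun y => d y b) (d' y b) y)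
    (heM : ∀ y ∈ Metric.ball τ 1, ∀ σ, |e y σ| ≤ M)
    (heM' : ∀ y ∈ Metric.ball τ 1, ∀ σ, |e' y σ| ≤ M)
    (hdM : ∀ y ∈ Metric.ball τ 1, ∀ b, |d y b| ≤ M)
    (hdM' : ∀ y ∈ Metric.ball τ 1, ∀ b, |d' y b| ≤ M) :
    HasDerivAt (fun y => 1 / m * Real.log (tiltedIntegral m ψ (d y) (fun _ => 1) (e y)))
      (tiltedMean m ψ (d τ) (fun v => gibbsAvg v (e' τ)) (e τ)
        + ∑ b, d τ b * d' τ b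
          * tiltedMean m ψ (d τ) (fun v => 1 - (1 - m) * gibbsAvg v (ψ b) ^ 2) (e τ)) τ := by
  have hψ1 : ∀ b σ, |ψ b σ| ≤ 1 := fun b σ => abs_le_one_of_sq_eq_one (hψ b σ)
  have h := hasDerivAt_tiltedIntegral hm₀ hm₁ hψ1 (X := 1) (by simp) he hd heM heM' hdM hdM'
  simp only [gibbsAvg_one, one_mul] at h
  have hpos := tiltedIntegral_one_pos hm₀ hm₁ hψ1 (d τ) (e τ)
  obtain ⟨C, -, hC⟩ := exists_bound_of_finite (e' τ)
  have hlin : ∀ k : B → ℝ, gibbsZ (e τ + randomEnergy ψ (d τ) k) ^ m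
      * (gibbsAvg (e τ + randomEnergy ψ (d τ) k) (e' τ + randomEnergy ψ (d' τ) k)
        - (1 - m) * gibbsAvg (e τ + randomEnergy ψ (d τ) k) (e' τ + randomEnergy ψ (d' τ) k))
      = m * (gibbsZ (e τ + randomEnergy ψ (d τ) k) ^ m
          * gibbsAvg (e τ + randomEnergy ψ (d τ) k) (e' τ)
        + ∑ b, d' τ b * (k b * (gibbsZ (e τ + randomEnergy ψ (d τ) k) ^ m
          * gibbsAvg (e τ + randomEnergy ψ (d τ) k) (ψ b)))) := by
    intro k
    have : gibbsAvg (e τ + randomEnergy ψ (d τ) k) (randomEnergy ψ (d' τ) k)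
        = ∑ b, d' τ b * k b * gibbsAvg (e τ + randomEnergy ψ (d τ) k) (ψ b) :=
      gibbsAvg_linearCombination _ (fun b => d' τ b * k b) ψ
    rw [gibbsAvg_add, this]
    have h2 : ∑ b, d' τ b * (k b * (gibbsZ (e τ + randomEnergy ψ (d τ) k) ^ m
          * gibbsAvg (e τ + randomEnergy ψ (d τ) k) (ψ b)))
        = gibbsZ (e τ + randomEnergy ψ (d τ) k) ^ m
          * ∑ b, d' τ b * k b * gibbsAvg (e τ + randomEnergy ψ (d τ) k) (ψ b) := by
      rw [Finset.mul_sum]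
      exact Finset.sum_congr rfl fun b _ => by ring
    rw [h2]; ring
  have hint : ∀ b, Integrable (fun k : B → ℝ => d' τ b * (k b *
      (gibbsZ (e τ + randomEnergy ψ (d τ) k) ^ m
          * gibbsAvg (e τ + randomEnergy ψ (d τ) k) (ψ b)))) (gaussianFamily B) := fun b =>
    (integrable_eval_mul_tilted hm₀ hm₁ hψ1 (d τ) (e τ) (continuous_gibbsAvg (ψ b))
      (fun v => abs_gibbsAvg_le v (hψ1 b)) b).const_mul _
  simp only [hlin] at h
  rw [integral_const_mul, integral_add
    (integrable_tilted hm₀ hm₁ hψ1 (d τ) (e τ) (continuous_gibbsAvg (e' τ))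
      (fun v => abs_gibbsAvg_le v hC)) (integrable_finsetSum _ fun b _ => hint b),
    integral_finsetSum _ fun b _ => hint b] at h
  simp only [integral_const_mul, integral_eval_mul_tilted hm₀ hm₁ hψ] at h
  have hT : ∀ F : (S → ℝ) → ℝ, ∫ k, gibbsZ (e τ + randomEnergy ψ (d τ) k) ^ m
      * F (e τ + randomEnergy ψ (d τ) k) ∂(gaussianFamily B)
        = tiltedIntegral m ψ (d τ) F (e τ) := fun F => rfl
  rw [hT fun v => gibbsAvg v (e' τ)] at h
  refine ((h.log hpos.ne').const_mul (1 / m)).congr_deriv ?_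
  simp only [tiltedMean, mul_div_assoc', ← Finset.sum_div, ← add_div]
  field_simp
  congr 1
  exact Finset.sum_congr rfl fun b _ => by ring

theorem integrable_tiltedMean_sq (hm₀ : 0 < m) (hm₁ : m < 1) (hψ : ∀ b σ, |ψ b σ| ≤ 1)
    (c : A → ℝ) (d : B → ℝ) {F : (S → ℝ) → ℝ} (hF : Continuous F) (hb : ∀ v, |F v| ≤ 1) :
    Integrable (fun g : A → ℝ => tiltedMean m ψ d F (randomEnergy φ c g) ^ 2)
      (gaussianFamily A) := by
  refine Integrable.of_bound
    ((stronglyMeasurable_tiltedMean φ c d hF).pow 2).aestronglyMeasurable 1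
    (Eventually.of_forall fun g => ?_)
  rw [Real.norm_eq_abs, abs_of_nonneg (sq_nonneg _)]
  exact (sq_le_one_iff_abs_le_one _).2 (abs_tiltedMean_le hm₀ hm₁ hψ d _ hF hb)

/-- Outer integration by parts. The derivative in `g_a` of the quotient `𝔼_k (Z ^ m ⟨φ_a⟩) / 𝔼_k Z ^ m`
produces the inner second moment from the numerator and the outer one from the denominator. -/
theorem integral_eval_mul_tiltedMean (hm₀ : 0 < m) (hm₁ : m < 1) (hψ : ∀ b σ, ψ b σ ^ 2 = 1)
    (hφ : ∀ a σ, φ a σ ^ 2 = 1) (c : A → ℝ) (d : B → ℝ) (a : A) :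
    ∫ g, g a * tiltedMean m ψ d (fun v => gibbsAvg v (φ a)) (randomEnergy φ c g)
        ∂(gaussianFamily A)
      = c a * (1
        - (1 - m) * ∫ g, tiltedMean m ψ d (fun v => gibbsAvg v (φ a) ^ 2) (randomEnergy φ c g)
            ∂(gaussianFamily A)
        - m * ∫ g, tiltedMean m ψ d (fun v => gibbsAvg v (φ a)) (randomEnergy φ c g) ^ 2
            ∂(gaussianFamily A)) := by
  classical
  have hψ1 : ∀ b σ, |ψ b σ| ≤ 1 := fun b σ => abs_le_one_of_sq_eq_one (hψ b σ)
  have hφ1 : ∀ a σ, |φ a σ| ≤ 1 := fun b σ => abs_le_one_of_sq_eq_one (hφ b σ)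
  have hc : Continuous fun v : S → ℝ => gibbsAvg v (φ a) := continuous_gibbsAvg _
  have hb : ∀ v : S → ℝ, |gibbsAvg v (φ a)| ≤ 1 := fun v => abs_gibbsAvg_le v (hφ1 a)
  have hc2 : Continuous fun v : S → ℝ => gibbsAvg v (φ a) ^ 2 := by fun_prop
  have hb2 : ∀ v : S → ℝ, |gibbsAvg v (φ a) ^ 2| ≤ 1 := fun v => by
    rw [abs_of_nonneg (sq_nonneg _)]; exact (sq_le_one_iff_abs_le_one _).2 (hb v)
  have hi1 := integrable_tiltedMean (φ := φ) hm₀ hm₁ hψ1 c d hc hb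
  have hi2 := integrable_tiltedMean (φ := φ) hm₀ hm₁ hψ1 c d hc2 hb2
  have hi3 := integrable_tiltedMean_sq (φ := φ) hm₀ hm₁ hψ1 c d hc hb
  have hi4 : Integrable (fun g : A → ℝ => g a) (gaussianFamily A) := by
    refine integrable_of_le_exp_sum_abs (C := 1) (K := 1)
      (continuous_apply a).aestronglyMeasurable fun k => ?_
    have h1 : |k a| ≤ ∑ b, |k b| :=
      Finset.single_le_sum (f := fun b => |k b|) (fun _ _ => abs_nonneg _) (Finset.mem_univ a)
    rw [one_mul, one_mul]
    linarith [Real.add_one_le_exp (∑ b, |k b|)]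
  have hi5 : Integrable (fun g : A → ℝ => g a * tiltedMean m ψ d (fun v => gibbsAvg v (φ a))
      (randomEnergy φ c g)) (gaussianFamily A) :=
    hi4.mul_bdd (c := 1) (stronglyMeasurable_tiltedMean φ c d hc).aestronglyMeasurable
      (Eventually.of_forall fun g => abs_tiltedMean_le hm₀ hm₁ hψ1 d _ hc hb)
  have hi6 : Integrable (fun g => 1 - (1 - m) * tiltedMean m ψ d (fun v => gibbsAvg v (φ a) ^ 2)
      (randomEnergy φ c g)) (gaussianFamily A) := (integrable_const _).sub (hi2.const_mul (1 - m))
  rw [integral_eval_mul_gaussianFamily a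
    (f' := fun g => c a * (1
        - (1 - m) * tiltedMean m ψ d (fun v => gibbsAvg v (φ a) ^ 2) (randomEnergy φ c g)
        - m * tiltedMean m ψ d (fun v => gibbsAvg v (φ a)) (randomEnergy φ c g) ^ 2)) ?_
    hi1 ((hi6.sub (hi3.const_mul m)).const_mul (c a)) hi5]
  · rw [integral_const_mul, integral_sub hi6 (hi3.const_mul m),
      integral_sub (integrable_const _) (hi2.const_mul _), integral_const_mul, integral_const_mul]
    simp
  · intro g
    have hsq : φ a * c a • φ a = c a • (1 : S → ℝ) := by
      ext σ
      simp only [Pi.mul_apply, Pi.smul_apply, smul_eq_mul, Pi.one_apply]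
      linear_combination c a * hφ a σ
    have hnum := hasDerivAt_tiltedIntegral_affine hm₀ hm₁ hψ1 (hφ1 a) d
      (randomEnergy φ c (Function.update g a 0)) (c a • φ a) (g a)
    have hden := hasDerivAt_tiltedIntegral_affine hm₀ hm₁ hψ1 (X := 1) (by simp) d
      (randomEnergy φ c (Function.update g a 0)) (c a • φ a) (g a)
    simp only [← randomEnergy_update, Function.update_eq_self, hsq, gibbsAvg_smul, gibbsAvg_one,
      one_mul] at hnum hden
    have hpos := tiltedIntegral_one_pos hm₀ hm₁ hψ1 d (randomEnergy φ c g)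
    refine (hnum.fun_div hden (by simpa using hpos.ne')).congr_deriv ?_
    simp only [Function.update_eq_self, tiltedMean]
    have e1 : tiltedIntegral m ψ d (fun v => c a * 1 - (1 - m) * (gibbsAvg v (φ a)
          * (c a * gibbsAvg v (φ a)))) (randomEnergy φ c g)
        = c a * (tiltedIntegral m ψ d (fun _ => 1) (randomEnergy φ c g)
          - (1 - m) * tiltedIntegral m ψ d (fun v => gibbsAvg v (φ a) ^ 2)
            (randomEnergy φ c g)) := by
      have j1 := integrable_tilted hm₀ hm₁ hψ1 d (randomEnergy φ c g) hc2 hb2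
      have j2 := integrable_tilted hm₀ hm₁ hψ1 d (randomEnergy φ c g)
        (F := fun _ => 1) continuous_const (C := 1) (by simp)
      rw [tiltedIntegral, tiltedIntegral, tiltedIntegral, ← integral_const_mul,
        ← integral_sub j2 (j1.const_mul _), ← integral_const_mul]
      congr 1; ext k; ring
    have e2 : tiltedIntegral m ψ d (fun v => c a * gibbsAvg v (φ a)
          - (1 - m) * (c a * gibbsAvg v (φ a))) (randomEnergy φ c g)
        = c a * m * tiltedIntegral m ψ d (fun v => gibbsAvg v (φ a)) (randomEnergy φ c g) := by
      rw [tiltedIntegral, tiltedIntegral, ← integral_const_mul]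
      congr 1; ext k; ring
    rw [e1, e2]
    field_simp

end TwoLevel

section TwoLevelOuter

variable {S A B : Type} [Fintype A] [Fintype B] [Fintype S]

/-- The two-level free energy `𝔼_g (1 / m) log 𝔼_k Z ^ m` at the energy
`∑_a c_a g_a φ_a + ∑_b d_b k_b ψ_b`. -/
noncomputable def twoLevelFreeEnergy (m : ℝ) (φ : A → S → ℝ) (ψ : B → S → ℝ) (c : A → ℝ)
    (d : B → ℝ) : ℝ :=
  ∫ g, 1 / m * Real.log (tiltedIntegral m ψ d (fun _ => 1) (randomEnergy φ c g)) ∂(gaussianFamily A)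

/-- The moment `𝔼_g (𝔼_k Z ^ m ⟨X⟩ / 𝔼_k Z ^ m) ^ 2`, whose two replicas share the outer noise
only. -/
noncomputable def outerMoment (m : ℝ) (φ : A → S → ℝ) (ψ : B → S → ℝ) (c : A → ℝ) (d : B → ℝ)
    (X : S → ℝ) : ℝ :=
  ∫ g, tiltedMean m ψ d (fun v => gibbsAvg v X) (randomEnergy φ c g) ^ 2 ∂(gaussianFamily A)

/-- The moment `𝔼_g (𝔼_k Z ^ m ⟨X⟩ ^ 2 / 𝔼_k Z ^ m)`, whose two replicas share the whole noise. -/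
noncomputable def innerMoment (m : ℝ) (φ : A → S → ℝ) (ψ : B → S → ℝ) (c : A → ℝ) (d : B → ℝ)
    (X : S → ℝ) : ℝ :=
  ∫ g, tiltedMean m ψ d (fun v => gibbsAvg v X ^ 2) (randomEnergy φ c g) ∂(gaussianFamily A)

theorem integrable_sum_abs : Integrable (fun g : A → ℝ => ∑ a, |g a|) (gaussianFamily A) := by
  refine integrable_of_le_exp_sum_abs (C := 1) (K := 1)
    (Continuous.aestronglyMeasurable (by fun_prop)) fun k => ?_
  rw [abs_of_nonneg (Finset.sum_nonneg fun _ _ => abs_nonneg _), one_mul, one_mul]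
  linarith [Real.add_one_le_exp (∑ b, |k b|)]

variable [Nonempty S] {m : ℝ} {ψ : B → S → ℝ} {φ : A → S → ℝ}

/-- The logarithm of the inner average grows at most linearly in the outer noise. -/
theorem integrable_log_tiltedIntegral (hm₀ : 0 < m) (hm₁ : m < 1) (hψ : ∀ b σ, |ψ b σ| ≤ 1)
    (hφ : ∀ a σ, |φ a σ| ≤ 1) (c : A → ℝ) (d : B → ℝ) :
    Integrable (fun g : A → ℝ =>
      Real.log (tiltedIntegral m ψ d (fun _ => 1) (randomEnergy φ c g))) (gaussianFamily A) := by
  obtain ⟨K₁, hK₁, hc⟩ := exists_bound_of_finite c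
  obtain ⟨K₂, hK₂, hd⟩ := exists_bound_of_finite d
  set C₁ := Fintype.card S * ∫ k : B → ℝ, Real.exp (K₂ * ∑ b, |k b|) ∂(gaussianFamily B) with hC₁
  set C₂ := ∫ k : B → ℝ, Real.exp (-K₂ * ∑ b, |k b|) ∂(gaussianFamily B) with hC₂
  have hC₁0 : 0 < C₁ := by
    have : (0 : ℝ) < Fintype.card S := by exact_mod_cast Fintype.card_pos
    exact mul_pos this (integral_exp_pos (integrable_exp_sum_abs K₂))
  have hC₂0 : 0 < C₂ := integral_exp_pos (integrable_exp_sum_abs (-K₂))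
  refine Integrable.mono' (g := fun g => K₁ * ∑ a, |g a| + (|Real.log C₁| + |Real.log C₂|))
    ((integrable_sum_abs.const_mul K₁).add (integrable_const _))
    (Real.measurable_log.comp
      (stronglyMeasurable_tiltedIntegral φ c d continuous_const).measurable).aestronglyMeasurable
    (Eventually.of_forall fun g => ?_)
  set G := K₁ * ∑ a, |g a| with hG
  have hpos := tiltedIntegral_one_pos hm₀ hm₁ hψ d (randomEnergy φ c g)
  have hint := integrable_tilted hm₀ hm₁ hψ d (randomEnergy φ c g)
    (F := fun _ => 1) continuous_const (C := 1) (by simp)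
  have hR : ∀ (k : B → ℝ) σ, |(randomEnergy φ c g + randomEnergy ψ d k) σ|
      ≤ G + K₂ * ∑ b, |k b| := fun k σ =>
    (abs_add_le _ _).trans (add_le_add (abs_randomEnergy_le hφ hc g σ)
      (abs_randomEnergy_le hψ hd k σ))
  have hup : tiltedIntegral m ψ d (fun _ => 1) (randomEnergy φ c g) ≤ Real.exp G * C₁ := by
    rw [hC₁, ← mul_assoc, ← integral_const_mul]
    refine integral_mono hint ((integrable_exp_sum_abs K₂).const_mul _) fun k => ?_
    have h := gibbsZ_rpow_le hm₀ hm₁ (by positivity) (hR k)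
    rw [Real.exp_add] at h
    simp only [mul_one]
    linarith
  have hlow : Real.exp (-G) * C₂ ≤ tiltedIntegral m ψ d (fun _ => 1) (randomEnergy φ c g) := by
    rw [hC₂, ← integral_const_mul]
    refine integral_mono ((integrable_exp_sum_abs (-K₂)).const_mul _) hint fun k => ?_
    have h := le_gibbsZ_rpow hm₀ hm₁ (by positivity) (hR k)
    rw [neg_add, Real.exp_add, ← neg_mul K₂] at h
    simp only [mul_one]
    linarith
  have h1 := Real.log_le_log hpos hup
  have h2 := Real.log_le_log (by positivity) hlow
  rw [Real.log_mul (Real.exp_pos _).ne' hC₁0.ne', Real.log_exp] at h1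
  rw [Real.log_mul (Real.exp_pos _).ne' hC₂0.ne', Real.log_exp] at h2
  rw [Real.norm_eq_abs, abs_le]
  constructor
  · linarith [neg_abs_le (Real.log C₂), abs_nonneg (Real.log C₁)]
  · linarith [le_abs_self (Real.log C₁), abs_nonneg (Real.log C₂)]

theorem tiltedMean_one_sub (hm₀ : 0 < m) (hm₁ : m < 1) (hψ : ∀ b σ, |ψ b σ| ≤ 1)
    (d : B → ℝ) (e : S → ℝ) {F : (S → ℝ) → ℝ} (hF : Continuous F) {C : ℝ} (hC : ∀ v, |F v| ≤ C)
    (r : ℝ) :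
    tiltedMean m ψ d (fun v => 1 - r * F v) e = 1 - r * tiltedMean m ψ d F e := by
  have hpos := tiltedIntegral_one_pos hm₀ hm₁ hψ d e
  have h1 := integrable_tilted hm₀ hm₁ hψ d e (F := fun _ => 1) continuous_const (C := 1) (by simp)
  have h : tiltedIntegral m ψ d (fun v => 1 - r * F v) e
      = tiltedIntegral m ψ d (fun _ => 1) e - r * tiltedIntegral m ψ d F e := by
    rw [tiltedIntegral, tiltedIntegral, tiltedIntegral, ← integral_const_mul,
      ← integral_sub h1 ((integrable_tilted hm₀ hm₁ hψ d e hF hC).const_mul r)]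
    congr 1; ext k; ring
  rw [tiltedMean, h, tiltedMean]
  field_simp

theorem abs_gibbsAvg_sq_le (v : S → ℝ) {X : S → ℝ} (hX : ∀ σ, |X σ| ≤ 1) :
    |gibbsAvg v X ^ 2| ≤ 1 := by
  rw [abs_of_nonneg (sq_nonneg _)]
  exact (sq_le_one_iff_abs_le_one _).2 (abs_gibbsAvg_le v hX)

/-- The interpolation formula: the derivative of the two-level free energy along a curve of
amplitudes involves only moments of pairs of replicas. -/
theorem hasDerivAt_twoLevelFreeEnergy (hm₀ : 0 < m) (hm₁ : m < 1) (hψ : ∀ b σ, ψ b σ ^ 2 = 1)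
    (hφ : ∀ a σ, φ a σ ^ 2 = 1) {c c' : ℝ → A → ℝ} {d d' : ℝ → B → ℝ} {K : ℝ}
    (hc : ∀ y a, HasDerivAt (fun y => c y a) (c' y a) y)
    (hd : ∀ y b, HasDerivAt (fun y => d y b) (d' y b) y)
    (hcK : ∀ y a, |c y a| ≤ K) (hcK' : ∀ y a, |c' y a| ≤ K)
    (hdK : ∀ y b, |d y b| ≤ K) (hdK' : ∀ y b, |d' y b| ≤ K) (hK : 0 ≤ K) (τ : ℝ) :
    HasDerivAt (fun y => twoLevelFreeEnergy m φ ψ (c y) (d y))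
      (∑ a, c τ a * c' τ a * (1 - (1 - m) * innerMoment m φ ψ (c τ) (d τ) (φ a)
          - m * outerMoment m φ ψ (c τ) (d τ) (φ a))
        + ∑ b, d τ b * d' τ b * (1 - (1 - m) * innerMoment m φ ψ (c τ) (d τ) (ψ b))) τ := by
  have hψ1 : ∀ b σ, |ψ b σ| ≤ 1 := fun b σ => abs_le_one_of_sq_eq_one (hψ b σ)
  have hφ1 : ∀ a σ, |φ a σ| ≤ 1 := fun b σ => abs_le_one_of_sq_eq_one (hφ b σ)
  have hφc : ∀ a, Continuous fun v : S → ℝ => gibbsAvg v (φ a) := fun a => continuous_gibbsAvg _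
  have hφb : ∀ a (v : S → ℝ), |gibbsAvg v (φ a)| ≤ 1 := fun a v => abs_gibbsAvg_le v (hφ1 a)
  have hψc : ∀ b, Continuous fun v : S → ℝ => gibbsAvg v (ψ b) ^ 2 := fun b =>
    (continuous_gibbsAvg _).pow 2
  have hψb : ∀ b (v : S → ℝ), |gibbsAvg v (ψ b) ^ 2| ≤ 1 := fun b v =>
    abs_gibbsAvg_sq_le v (hψ1 b)
  have hψ2c : ∀ b, Continuous fun v : S → ℝ => 1 - (1 - m) * gibbsAvg v (ψ b) ^ 2 := fun b =>
    continuous_const.sub (continuous_const.mul (hψc b))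
  have hψ2b : ∀ b (v : S → ℝ), |1 - (1 - m) * gibbsAvg v (ψ b) ^ 2| ≤ 1 := fun b v => by
    have h := hψb b v
    rw [abs_of_nonneg (sq_nonneg _)] at h
    rw [abs_le]
    constructor <;> nlinarith [sq_nonneg (gibbsAvg v (ψ b))]
  -- the pointwise derivative, before the outer integration by parts
  have hpt : ∀ y (g : A → ℝ), HasDerivAt (fun y => 1 / m * Real.log
        (tiltedIntegral m ψ (d y) (fun _ => 1) (randomEnergy φ (c y) g)))
      (∑ a, c' y a * g a * tiltedMean m ψ (d y) (fun v => gibbsAvg v (φ a)) (randomEnergy φ (c y) g)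
        + ∑ b, d y b * d' y b * tiltedMean m ψ (d y)
          (fun v => 1 - (1 - m) * gibbsAvg v (ψ b) ^ 2) (randomEnergy φ (c y) g)) y := by
    intro y g
    have hG : 0 ≤ K * ∑ a, |g a| := by positivity
    have h := hasDerivAt_log_tiltedIntegral hm₀ hm₁ hψ (τ := y) (M := K * ∑ a, |g a| + K)
      (e := fun y => randomEnergy φ (c y) g) (e' := fun y => randomEnergy φ (c' y) g)
      (d := d) (d' := d')
      (fun y _ σ => HasDerivAt.fun_sum fun a _ => ((hc y a).mul_const _).mul_const _)
      (fun y _ b => hd y b)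
      (fun y _ σ => (abs_randomEnergy_le hφ1 (hcK y) g σ).trans (by linarith))
      (fun y _ σ => (abs_randomEnergy_le hφ1 (hcK' y) g σ).trans (by linarith))
      (fun y _ b => (hdK y b).trans (by linarith)) (fun y _ b => (hdK' y b).trans (by linarith))
    refine h.congr_deriv ?_
    congr 1
    rw [← tiltedMean_sum hm₀ hm₁ hψ1 (d y) (randomEnergy φ (c y) g) (fun a => c' y a * g a)
      hφc hφb]
    congr 1
    funext v
    exact gibbsAvg_linearCombination v (fun a => c' y a * g a) φ
  have hi1 : ∀ a, Integrable (fun g : A → ℝ => c' τ a * g a * tiltedMean m ψ (d τ)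
      (fun v => gibbsAvg v (φ a)) (randomEnergy φ (c τ) g)) (gaussianFamily A) := fun a => by
    refine Integrable.mono' (integrable_sum_abs.const_mul K)
      (((measurable_pi_apply a).const_mul _).mul
        (stronglyMeasurable_tiltedMean φ (c τ) (d τ) (hφc a)).measurable).aestronglyMeasurable
      (Eventually.of_forall fun g => ?_)
    have h1 : |g a| ≤ ∑ a, |g a| :=
      Finset.single_le_sum (f := fun b => |g b|) (fun _ _ => abs_nonneg _) (Finset.mem_univ a)
    rw [Real.norm_eq_abs, abs_mul, abs_mul]
    have h2 : |c' τ a| * |g a| ≤ K * ∑ a, |g a| := mul_le_mul (hcK' τ a) h1 (abs_nonneg _) hK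
    exact (mul_le_mul h2 (abs_tiltedMean_le hm₀ hm₁ hψ1 _ _ (hφc a) (hφb a)) (abs_nonneg _)
      (by positivity)).trans_eq (mul_one _)
  have hi2 : ∀ b, Integrable (fun g : A → ℝ => d τ b * d' τ b * tiltedMean m ψ (d τ)
      (fun v => 1 - (1 - m) * gibbsAvg v (ψ b) ^ 2) (randomEnergy φ (c τ) g))
      (gaussianFamily A) := fun b =>
    (integrable_tiltedMean hm₀ hm₁ hψ1 (c τ) (d τ) (hψ2c b) (hψ2b b)).const_mul _
  have hmain := (hasDerivAt_integral_of_dominated_loc_of_deriv_le (μ := gaussianFamily A)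
    (s := Metric.ball τ 1)
    (F := fun y g => 1 / m * Real.log
      (tiltedIntegral m ψ (d y) (fun _ => 1) (randomEnergy φ (c y) g)))
    (bound := fun g => K * ∑ a, |g a| + Fintype.card B * (K * K))
    (Metric.ball_mem_nhds τ one_pos)
    (Eventually.of_forall fun y =>
      ((integrable_log_tiltedIntegral hm₀ hm₁ hψ1 hφ1 (c y) (d y)).const_mul _).1)
    ((integrable_log_tiltedIntegral hm₀ hm₁ hψ1 hφ1 (c τ) (d τ)).const_mul _)
    ((integrable_finsetSum _ fun a _ => hi1 a).add (integrable_finsetSum _ fun b _ => hi2 b)).1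
    (Eventually.of_forall fun g y _ => ?_)
    ((integrable_sum_abs.const_mul K).add (integrable_const _))
    (Eventually.of_forall fun g y _ => hpt y g)).2
  · refine hmain.congr_deriv ?_
    rw [integral_add (integrable_finsetSum _ fun a _ => hi1 a)
      (integrable_finsetSum _ fun b _ => hi2 b), integral_finsetSum _ fun a _ => hi1 a,
      integral_finsetSum _ fun b _ => hi2 b]
    congr 1
    · refine Finset.sum_congr rfl fun a _ => ?_
      simp only [mul_assoc]
      rw [integral_const_mul, integral_eval_mul_tiltedMean hm₀ hm₁ hψ hφ]
      simp only [innerMoment, outerMoment]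
      ring
    · refine Finset.sum_congr rfl fun b _ => ?_
      rw [integral_const_mul, innerMoment]
      congr 1
      have hi := integrable_tiltedMean (φ := φ) hm₀ hm₁ hψ1 (c τ) (d τ) (hψc b) (hψb b)
      have h1 : ∀ g, tiltedMean m ψ (d τ) (fun v => 1 - (1 - m) * gibbsAvg v (ψ b) ^ 2)
          (randomEnergy φ (c τ) g) = 1 - (1 - m) * tiltedMean m ψ (d τ)
            (fun v => gibbsAvg v (ψ b) ^ 2) (randomEnergy φ (c τ) g) := fun g =>
        tiltedMean_one_sub hm₀ hm₁ hψ1 _ _ (hψc b) (hψb b) _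
      simp only [h1]
      rw [integral_sub (integrable_const _) (hi.const_mul (1 - m)), integral_const_mul]
      simp
  · refine (norm_add_le _ _).trans (add_le_add ?_ ?_)
    · rw [Finset.mul_sum]
      refine (norm_sum_le _ _).trans (Finset.sum_le_sum fun a _ => ?_)
      rw [Real.norm_eq_abs, abs_mul, abs_mul]
      exact (mul_le_mul (mul_le_mul_of_nonneg_right (hcK' y a) (abs_nonneg _))
        (abs_tiltedMean_le hm₀ hm₁ hψ1 _ _ (hφc a) (hφb a)) (abs_nonneg _)
        (by positivity)).trans_eq (mul_one _)
    · rw [← nsmul_eq_mul, ← Finset.card_univ]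
      refine (norm_sum_le _ _).trans (Finset.sum_le_card_nsmul _ _ _ fun b _ => ?_)
      rw [Real.norm_eq_abs, abs_mul, abs_mul]
      exact (mul_le_mul (mul_le_mul (hdK y b) (hdK' y b) (abs_nonneg _) hK)
        (abs_tiltedMean_le hm₀ hm₁ hψ1 _ _ (hψ2c b) (hψ2b b)) (abs_nonneg _)
        (by positivity)).trans_eq (mul_one _)

end TwoLevelOuter

/-! ### The spin glass as a two-level system -/

section Translation

variable {p N : ℕ}

/-- The observables coupled to the outer noise: the products of spins over `p`-tuples, coupled to
`J`, and the single spins, coupled to `J₁`. -/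
def outerObservable : Tuples p N ⊕ Fin N → Config N → ℝ :=
  Sum.elim (fun I σ => ∏ i ∈ I.1, spin σ i) (fun i σ => spin σ i)

/-- The single spins, coupled to the inner noise `J₂`. -/
def spinObservable (i : Fin N) (σ : Config N) : ℝ := spin σ i

/-- Amplitudes of the outer noise: `s` for the couplings `J`, `u` for the random field `J₁`. -/
def outerAmplitude (s u : ℝ) : Tuples p N ⊕ Fin N → ℝ := Sum.elim (fun _ => s) (fun _ => u)

theorem spin_sq (σ : Config N) (i : Fin N) : spin σ i ^ 2 = 1 := by
  rw [spin]
  rcases Int.units_eq_one_or (σ i) with h | h <;> simp [h]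

theorem prod_spin_sq {ι : Type} (s : Finset ι) (f : ι → Fin N) (σ : Config N) :
    (∏ j ∈ s, spin σ (f j)) ^ 2 = 1 := by
  rw [← Finset.prod_pow]
  exact Finset.prod_eq_one fun j _ => spin_sq σ (f j)

theorem outerObservable_sq (a : Tuples p N ⊕ Fin N) (σ : Config N) :
    outerObservable a σ ^ 2 = 1 := by
  rcases a with I | i
  · exact prod_spin_sq I.1 id σ
  · exact spin_sq σ i

theorem spinObservable_sq (i : Fin N) (σ : Config N) : spinObservable i σ ^ 2 = 1 := spin_sq σ i

theorem abs_spinObservable_le (i : Fin N) (σ : Config N) : |spinObservable i σ| ≤ 1 :=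
  abs_le_one_of_sq_eq_one (spin_sq σ i)

theorem randomEnergy_outer (s u : ℝ) (J : Tuples p N → ℝ) (J₁ : Fin N → ℝ) (σ : Config N) :
    randomEnergy outerObservable (outerAmplitude s u) (Sum.elim J J₁) σ
      = s * couplingSum J σ + u * ∑ i, J₁ i * spin σ i := by
  simp [randomEnergy, outerObservable, outerAmplitude, couplingSum, Finset.mul_sum, mul_assoc]

theorem randomEnergy_spin (w : ℝ) (J₂ : Fin N → ℝ) (σ : Config N) :
    randomEnergy spinObservable (fun _ => w) J₂ σ = w * ∑ i, J₂ i * spin σ i := by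
  simp [randomEnergy, spinObservable, Finset.mul_sum, mul_assoc]

/-- Averages over the outer noise are iterated averages over `J` and `J₁`. -/
theorem integral_outer {ι κ : Type} [Fintype ι] [Fintype κ] {h : (ι ⊕ κ → ℝ) → ℝ}
    (hh : Integrable h (gaussianFamily (ι ⊕ κ))) :
    ∫ g, h g ∂(gaussianFamily (ι ⊕ κ))
      = ∫ J, ∫ J₁, h (Sum.elim J J₁) ∂(gaussianFamily κ) ∂(gaussianFamily ι) := by
  have hmp := measurePreserving_sumPiEquivProdPi_symm (X := fun _ : ι ⊕ κ => ℝ)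
    (fun _ => gaussianReal 0 1)
  have hcoe : ∀ z : (ι → ℝ) × (κ → ℝ),
      (MeasurableEquiv.sumPiEquivProdPi fun _ : ι ⊕ κ => ℝ).symm z = Sum.elim z.1 z.2 := by
    rintro ⟨a, b⟩
    ext (i | j) <;> rfl
  unfold gaussianFamily at hh ⊢
  have hint := (hmp.integrable_comp_emb (MeasurableEquiv.measurableEmbedding _)).2 hh
  rw [← hmp.integral_comp']
  refine (integral_prod _ hint).trans ?_
  simp only [Function.comp_apply, hcoe]

variable {m Q₁ Q₂ t x₁ x₂ s u w : ℝ}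

theorem boltzmann_eq (hs : √(t * p.factorial / (2 * (N : ℝ) ^ (p - 1))) = s)
    (hu : √x₁ * fieldStrength p Q₁ = u) (hw : √x₂ * fieldStrength p Q₂ = w)
    (J : Tuples p N → ℝ) (J₁ J₂ : Fin N → ℝ) (σ : Config N) :
    boltzmann Q₁ Q₂ t x₁ x₂ J J₁ J₂ σ
      = Real.exp ((randomEnergy outerObservable (outerAmplitude s u) (Sum.elim J J₁)
          + randomEnergy spinObservable (fun _ => w) J₂) σ) := by
  rw [Pi.add_apply, randomEnergy_outer, randomEnergy_spin, boltzmann, hs, hu, hw]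

theorem Z₂_eq (hs : √(t * p.factorial / (2 * (N : ℝ) ^ (p - 1))) = s)
    (hu : √x₁ * fieldStrength p Q₁ = u) (hw : √x₂ * fieldStrength p Q₂ = w)
    (J : Tuples p N → ℝ) (J₁ J₂ : Fin N → ℝ) :
    Z₂ Q₁ Q₂ t x₁ x₂ J J₁ J₂
      = gibbsZ (randomEnergy outerObservable (outerAmplitude s u) (Sum.elim J J₁)
          + randomEnergy spinObservable (fun _ => w) J₂) := by
  simp only [Z₂, gibbsZ, boltzmann_eq hs hu hw]

theorem sum_mul_weight₂ (hs : √(t * p.factorial / (2 * (N : ℝ) ^ (p - 1))) = s)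
    (hu : √x₁ * fieldStrength p Q₁ = u) (hw : √x₂ * fieldStrength p Q₂ = w)
    (J : Tuples p N → ℝ) (J₁ J₂ : Fin N → ℝ) (X : Config N → ℝ) :
    ∑ σ, X σ * weight₂ Q₁ Q₂ t x₁ x₂ J J₁ J₂ σ
      = gibbsAvg (randomEnergy outerObservable (outerAmplitude s u) (Sum.elim J J₁)
          + randomEnergy spinObservable (fun _ => w) J₂) X := by
  simp only [weight₂, Z₂_eq hs hu hw, boltzmann_eq hs hu hw, gibbsAvg, Finset.sum_div,
    mul_div_assoc]

/-- The normalisation `Z₁ ^ m` of `f₂` is the inner average of `Z₂ ^ m`. -/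
theorem Z₁_rpow (hm₀ : 0 < m) (hs : √(t * p.factorial / (2 * (N : ℝ) ^ (p - 1))) = s)
    (hu : √x₁ * fieldStrength p Q₁ = u) (hw : √x₂ * fieldStrength p Q₂ = w)
    (J : Tuples p N → ℝ) (J₁ : Fin N → ℝ) :
    Z₁ m Q₁ Q₂ t x₁ x₂ J J₁ ^ m = tiltedIntegral m spinObservable (fun _ => w) (fun _ => 1)
      (randomEnergy outerObservable (outerAmplitude s u) (Sum.elim J J₁)) := by
  simp only [Z₁, Z₂_eq hs hu hw, tiltedIntegral, mul_one]
  rw [← Real.rpow_mul (integral_nonneg fun k => (gibbsZ_rpow_pos m _).le),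
    one_div_mul_cancel hm₀.ne', Real.rpow_one]

/-- The average `𝔼₂ (f₂ F)` as a tilted mean. -/
theorem integral_f₂_mul (hm₀ : 0 < m) (hs : √(t * p.factorial / (2 * (N : ℝ) ^ (p - 1))) = s)
    (hu : √x₁ * fieldStrength p Q₁ = u) (hw : √x₂ * fieldStrength p Q₂ = w)
    (J : Tuples p N → ℝ) (J₁ : Fin N → ℝ) (F : (Config N → ℝ) → ℝ) :
    ∫ J₂, f₂ m Q₁ Q₂ t x₁ x₂ J J₁ J₂
        * F (randomEnergy outerObservable (outerAmplitude s u) (Sum.elim J J₁)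
          + randomEnergy spinObservable (fun _ => w) J₂) ∂(gaussianFamily (Fin N))
      = tiltedMean m spinObservable (fun _ => w) F
        (randomEnergy outerObservable (outerAmplitude s u) (Sum.elim J J₁)) := by
  simp only [f₂, Z₁_rpow hm₀ hs hu hw, Z₂_eq hs hu hw]
  generalize hW : tiltedIntegral m spinObservable (fun _ => w) (fun _ => 1)
    (randomEnergy outerObservable (outerAmplitude s u) (Sum.elim J J₁)) = W
  rw [tiltedMean, hW, tiltedIntegral, ← integral_div]
  congr 1
  ext k
  ring

theorem sum_mul_weight₁ (hm₀ : 0 < m) (hm₁ : m < 1)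
    (hs : √(t * p.factorial / (2 * (N : ℝ) ^ (p - 1))) = s)
    (hu : √x₁ * fieldStrength p Q₁ = u) (hw : √x₂ * fieldStrength p Q₂ = w)
    (J : Tuples p N → ℝ) (J₁ : Fin N → ℝ) (X : Config N → ℝ) :
    ∑ σ, X σ * weight₁ m Q₁ Q₂ t x₁ x₂ J J₁ σ
      = tiltedMean m spinObservable (fun _ => w) (fun v => gibbsAvg v X)
        (randomEnergy outerObservable (outerAmplitude s u) (Sum.elim J J₁)) := by
  -- each weight is the tilted mean of an indicator function
  have h1 : ∀ σ, weight₁ m Q₁ Q₂ t x₁ x₂ J J₁ σ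
      = tiltedMean m spinObservable (fun _ => w) (fun v => gibbsAvg v (Pi.single σ 1))
        (randomEnergy outerObservable (outerAmplitude s u) (Sum.elim J J₁)) := fun σ => by
    rw [← integral_f₂_mul hm₀ hs hu hw, weight₁]
    simp only [← sum_mul_weight₂ hs hu hw]
    simp [Pi.single_apply]
  have hb : ∀ σ τ : Config N, |(Pi.single σ (1 : ℝ) : Config N → ℝ) τ| ≤ 1 := fun σ τ => by
    rw [Pi.single_apply]; split_ifs <;> simp
  simp only [h1]
  rw [← tiltedMean_sum hm₀ hm₁ abs_spinObservable_le _ _ X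
    (fun σ => continuous_gibbsAvg _) (C := 1) fun σ v => abs_gibbsAvg_le v (hb σ)]
  congr 1
  funext v
  rw [← gibbsAvg_linearCombination]
  congr 1
  funext σ
  simp [Pi.single_apply]

theorem replicaState_sum {ι : Type} [Fintype ι] (r : ℝ) (X : ι → Config N → ℝ)
    (W : Config N → ℝ) :
    replicaState W (fun σ σ' => r * ∑ j, X j σ * X j σ') = r * ∑ j, (∑ σ, X j σ * W σ) ^ 2 := by
  calc replicaState W (fun σ σ' => r * ∑ j, X j σ * X j σ')
      = ∑ σ, ∑ σ', ∑ j, r * (X j σ * W σ * (X j σ' * W σ')) := by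
        simp only [replicaState, Finset.mul_sum, Finset.sum_mul]
        refine Finset.sum_congr rfl fun σ _ => Finset.sum_congr rfl fun σ' _ =>
          Finset.sum_congr rfl fun j _ => ?_
        ring
    _ = ∑ j, ∑ σ, ∑ σ', r * (X j σ * W σ * (X j σ' * W σ')) := by
        rw [Finset.sum_comm (s := Finset.univ (α := ι))]
        exact Finset.sum_congr rfl fun σ _ => Finset.sum_comm
    _ = r * ∑ j, (∑ σ, X j σ * W σ) ^ 2 := by
        rw [Finset.mul_sum]
        refine Finset.sum_congr rfl fun j _ => ?_
        rw [sq, Finset.sum_mul_sum]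
        simp only [Finset.mul_sum]

/-- The average `⟨·⟩₁` of a kernel `r ∑_j X_j(σ) X_j(σ')`. -/
theorem bracket₁_sum (hm₀ : 0 < m) (hm₁ : m < 1)
    (hs : √(t * p.factorial / (2 * (N : ℝ) ^ (p - 1))) = s)
    (hu : √x₁ * fieldStrength p Q₁ = u) (hw : √x₂ * fieldStrength p Q₂ = w)
    {ι : Type} [Fintype ι] (r : ℝ) (X : ι → Config N → ℝ) (hX : ∀ j σ, |X j σ| ≤ 1) :
    bracket₁ p N m Q₁ Q₂ t x₁ x₂ (fun σ σ' => r * ∑ j, X j σ * X j σ')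
      = r * ∑ j, outerMoment m (outerObservable (p := p)) spinObservable (outerAmplitude s u)
        (fun _ => w) (X j) := by
  have hi : ∀ j, Integrable (fun g => tiltedMean m spinObservable (fun _ => w)
      (fun v => gibbsAvg v (X j)) (randomEnergy (outerObservable (p := p) (N := N))
        (outerAmplitude s u) g) ^ 2) (gaussianFamily (Tuples p N ⊕ Fin N)) := fun j =>
    integrable_tiltedMean_sq hm₀ hm₁ abs_spinObservable_le _ _ (continuous_gibbsAvg _)
      fun v => abs_gibbsAvg_le v (hX j)
  simp only [bracket₁, replicaState_sum, sum_mul_weight₁ hm₀ hm₁ hs hu hw]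
  rw [← integral_outer (h := fun g => r * ∑ j, tiltedMean m spinObservable (fun _ => w)
      (fun v => gibbsAvg v (X j)) (randomEnergy (outerObservable (p := p) (N := N))
        (outerAmplitude s u) g) ^ 2) ((integrable_finsetSum _ fun j _ => hi j).const_mul r),
    integral_const_mul, integral_finsetSum _ fun j _ => hi j]
  rfl

/-- The average `⟨·⟩₂` of a kernel `r ∑_j X_j(σ) X_j(σ')`. -/
theorem bracket₂_sum (hm₀ : 0 < m) (hm₁ : m < 1)
    (hs : √(t * p.factorial / (2 * (N : ℝ) ^ (p - 1))) = s)
    (hu : √x₁ * fieldStrength p Q₁ = u) (hw : √x₂ * fieldStrength p Q₂ = w)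
    {ι : Type} [Fintype ι] (r : ℝ) (X : ι → Config N → ℝ) (hX : ∀ j σ, |X j σ| ≤ 1) :
    bracket₂ p N m Q₁ Q₂ t x₁ x₂ (fun σ σ' => r * ∑ j, X j σ * X j σ')
      = r * ∑ j, innerMoment m (outerObservable (p := p)) spinObservable (outerAmplitude s u)
        (fun _ => w) (X j) := by
  have hc : ∀ j, Continuous fun v : Config N → ℝ => gibbsAvg v (X j) ^ 2 := fun j =>
    (continuous_gibbsAvg _).pow 2
  have hb : ∀ j (v : Config N → ℝ), |gibbsAvg v (X j) ^ 2| ≤ 1 := fun j v =>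
    abs_gibbsAvg_sq_le v (hX j)
  have hi : ∀ j, Integrable (fun g => tiltedMean m spinObservable (fun _ => w)
      (fun v => gibbsAvg v (X j) ^ 2) (randomEnergy (outerObservable (p := p) (N := N))
        (outerAmplitude s u) g)) (gaussianFamily (Tuples p N ⊕ Fin N)) := fun j =>
    integrable_tiltedMean hm₀ hm₁ abs_spinObservable_le _ _ (hc j) (hb j)
  have h2 : ∀ J J₁, ∫ J₂, f₂ m Q₁ Q₂ t x₁ x₂ J J₁ J₂ * (r * ∑ j, gibbsAvg
        (randomEnergy (outerObservable (p := p) (N := N)) (outerAmplitude s u) (Sum.elim J J₁)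
          + randomEnergy spinObservable (fun _ => w) J₂) (X j) ^ 2) ∂(gaussianFamily (Fin N))
      = r * ∑ j, tiltedMean m spinObservable (fun _ => w) (fun v => gibbsAvg v (X j) ^ 2)
        (randomEnergy (outerObservable (p := p) (N := N)) (outerAmplitude s u)
          (Sum.elim J J₁)) := fun J J₁ => by
    rw [integral_f₂_mul hm₀ hs hu hw J J₁ fun v => r * ∑ j, gibbsAvg v (X j) ^ 2, Finset.mul_sum,
      ← tiltedMean_sum hm₀ hm₁ abs_spinObservable_le _ _ (fun _ => r) hc hb]
    simp only [Finset.mul_sum]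
  simp only [bracket₂, replicaState_sum, sum_mul_weight₂ hs hu hw, h2]
  rw [← integral_outer (h := fun g => r * ∑ j, tiltedMean m spinObservable (fun _ => w)
      (fun v => gibbsAvg v (X j) ^ 2) (randomEnergy (outerObservable (p := p) (N := N))
        (outerAmplitude s u) g)) ((integrable_finsetSum _ fun j _ => hi j).const_mul r),
    integral_const_mul, integral_finsetSum _ fun j _ => hi j]
  rfl

end Translation

/-! ### The `p`-spin interaction and the `p`-th power of the overlap -/

section Overlap

variable {p N : ℕ}

/-- The product of the spins at the sites of a `p`-tuple, repetitions allowed. -/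
def spinProduct (f : Fin p → Fin N) (σ : Config N) : ℝ := ∏ j, spin σ (f j)

theorem abs_spinProduct_le (f : Fin p → Fin N) (σ : Config N) : |spinProduct f σ| ≤ 1 :=
  abs_le_one_of_sq_eq_one (prod_spin_sq Finset.univ f σ)

theorem overlap_pow (σ σ' : Config N) :
    overlap σ σ' ^ p
      = 1 / (N : ℝ) ^ p * ∑ f : Fin p → Fin N, spinProduct f σ * spinProduct f σ' := by
  rw [overlap, mul_pow, one_div_pow, Fintype.sum_pow]
  simp only [spinProduct, Finset.prod_mul_distrib]

/-- Injective `p`-tuples are `p`-element sets with an enumeration. -/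
noncomputable def tuplesSigmaEquivEmbedding (p N : ℕ) :
    (Σ I : Tuples p N, Fin p ≃ I.1) ≃ (Fin p ↪ Fin N) :=
  Equiv.ofBijective
    (fun z => z.2.toEmbedding.trans (Function.Embedding.subtype _)) <| by
    constructor
    · rintro ⟨⟨I, hI⟩, e⟩ ⟨⟨I', hI'⟩, e'⟩ h
      have h1 : ∀ j, (e j : Fin N) = e' j := fun j => DFunLike.congr_fun h j
      have h2 : I = I' := by
        ext i
        constructor
        · intro hi
          have := h1 (e.symm ⟨i, hi⟩)
          rw [Equiv.apply_symm_apply] at this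
          exact (show i = _ from this) ▸ (e' (e.symm ⟨i, hi⟩)).2
        · intro hi
          have := h1 (e'.symm ⟨i, hi⟩)
          rw [Equiv.apply_symm_apply] at this
          exact (show _ = i from this) ▸ (e (e'.symm ⟨i, hi⟩)).2
      subst h2
      congr 1
      ext j
      exact congrArg Fin.val (h1 j)
    · intro f
      refine ⟨⟨⟨Finset.univ.map f, by simp⟩, Equiv.ofBijective
        (fun j => ⟨f j, Finset.mem_map_of_mem f (Finset.mem_univ j)⟩) ⟨fun i j h => ?_, ?_⟩⟩, ?_⟩
      · exact f.injective (congrArg Subtype.val h)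
      · rintro ⟨i, hi⟩
        obtain ⟨j, -, rfl⟩ := Finset.mem_map.1 hi
        exact ⟨j, rfl⟩
      · ext j; rfl

theorem spinProduct_tuplesSigmaEquivEmbedding (z : Σ I : Tuples p N, Fin p ≃ I.1) :
    spinProduct (tuplesSigmaEquivEmbedding p N z) = outerObservable (Sum.inl z.1) := by
  funext σ
  simp only [spinProduct, outerObservable, Sum.elim_inl]
  rw [← Finset.prod_coe_sort z.1.1 fun i => spin σ i]
  exact Fintype.prod_equiv z.2 _ _ fun j => rfl

/-- The sum over `p`-tuples of sites splits into `p!` copies of the sum over `p`-element sets and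
the tuples with a repeated site, of which there are `N ^ p - N (N - 1) ⋯ (N - p + 1)`. -/
theorem abs_sum_spinProduct_sub_le (M : (Config N → ℝ) → ℝ)
    (hM : ∀ f : Fin p → Fin N, |M (spinProduct f)| ≤ 1) :
    |∑ f : Fin p → Fin N, M (spinProduct f)
        - p.factorial * ∑ I : Tuples p N, M (outerObservable (Sum.inl I))|
      ≤ (N : ℝ) ^ p - N.descFactorial p := by
  classical
  have hinj : ∑ f : Fin p → Fin N with Function.Injective f, M (spinProduct f)
      = p.factorial * ∑ I : Tuples p N, M (outerObservable (Sum.inl I)) := by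
    have h1 : ∑ f : Fin p → Fin N with Function.Injective f, M (spinProduct f)
        = ∑ f : Fin p ↪ Fin N, M (spinProduct f) := by
      rw [← Finset.sum_subtype_eq_sum_filter, Finset.subtype_univ]
      exact Fintype.sum_equiv (Equiv.subtypeInjectiveEquivEmbedding _ _) _ _ fun f => rfl
    rw [h1, ← Fintype.sum_equiv (tuplesSigmaEquivEmbedding p N)
      (fun z => M (outerObservable (Sum.inl z.1))) _
      fun z => by rw [spinProduct_tuplesSigmaEquivEmbedding], Fintype.sum_sigma, Finset.mul_sum]
    refine Finset.sum_congr rfl fun I _ => ?_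
    have hcard : Fintype.card (Fin p ≃ I.1) = p.factorial := by
      have e : Fin p ≃ I.1 := (Fintype.equivFinOfCardEq (by simpa using I.2)).symm
      rw [Fintype.card_equiv e, Fintype.card_fin]
    change ∑ _ : Fin p ≃ I.1, M (outerObservable (Sum.inl I)) = _
    rw [Finset.sum_const, Finset.card_univ, hcard, nsmul_eq_mul]
  have hcardinj : ((Finset.univ.filter fun f : Fin p → Fin N => Function.Injective f).card : ℝ)
      = N.descFactorial p := by
    rw [← Fintype.card_subtype, Fintype.card_congr (Equiv.subtypeInjectiveEquivEmbedding _ _),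
      Fintype.card_embedding_eq, Fintype.card_fin, Fintype.card_fin]
  have hcard : ((Finset.univ.filter fun f : Fin p → Fin N => ¬ Function.Injective f).card : ℝ)
      = (N : ℝ) ^ p - N.descFactorial p := by
    have h := Finset.card_filter_add_card_filter_not (s := (Finset.univ : Finset (Fin p → Fin N)))
      (fun f => Function.Injective f)
    rw [Finset.card_univ, Fintype.card_fun, Fintype.card_fin, Fintype.card_fin] at h
    rw [← hcardinj, eq_sub_iff_add_eq, add_comm]
    exact_mod_cast h
  rw [← hinj, ← Finset.sum_filter_add_sum_filter_not Finset.univ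
    (fun f : Fin p → Fin N => Function.Injective f), add_sub_cancel_left, ← hcard]
  refine (Finset.abs_sum_le_sum_abs _ _).trans ?_
  refine (Finset.sum_le_card_nsmul _ _ 1 fun f _ => hM f).trans_eq ?_
  simp

theorem tendsto_descFactorial_div_pow (p : ℕ) :
    Tendsto (fun N : ℕ => (N.descFactorial p : ℝ) / (N : ℝ) ^ p) atTop (𝓝 1) := by
  have h := isEquivalent_descFactorial p
  refine (Asymptotics.isEquivalent_iff_tendsto_one ?_).1 h
  filter_upwards [eventually_ge_atTop 1] with N hN
  have : (0 : ℝ) < N := by exact_mod_cast hN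
  positivity

end Overlap

/-! ### The one-body problem -/

section OneBody

variable {p N : ℕ}

/-- Sums over configurations of products over sites factorize. -/
theorem sum_prod_spin (f : Fin N → ℝ → ℝ) :
    ∑ σ : Config N, ∏ i, f i (spin σ i) = ∏ i, (f i 1 + f i (-1)) := by
  have h := Finset.prod_univ_sum (fun _ : Fin N => (Finset.univ : Finset ℤˣ))
    (fun i ε => f i ((ε : ℤ) : ℝ))
  rw [Fintype.piFinset_univ] at h
  have h2 : ∀ i, ∑ ε : ℤˣ, f i ((ε : ℤ) : ℝ) = f i 1 + f i (-1) := fun i => by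
    rw [show (Finset.univ : Finset ℤˣ) = {1, -1} from rfl, Finset.sum_pair (by decide)]
    simp
  simp only [h2] at h
  exact h.symm

theorem gibbsZ_field (h : Fin N → ℝ) :
    gibbsZ (fun σ : Config N => ∑ i, h i * spin σ i) = ∏ i, (2 * Real.cosh (h i)) := by
  simp only [gibbsZ, Real.exp_sum]
  rw [sum_prod_spin fun i x => Real.exp (h i * x)]
  refine Finset.prod_congr rfl fun i _ => ?_
  rw [Real.cosh_eq]; ring_nf

theorem gibbsAvg_field (h : Fin N → ℝ) (i : Fin N) :
    gibbsAvg (fun σ : Config N => ∑ i, h i * spin σ i) (spinObservable i) = Real.tanh (h i) := by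
  rw [gibbsAvg, gibbsZ_field]
  have h1 : ∀ σ : Config N, spinObservable i σ * Real.exp (∑ i, h i * spin σ i)
      = ∏ j, ((if j = i then spin σ j else 1) * Real.exp (h j * spin σ j)) := fun σ => by
    rw [Finset.prod_mul_distrib, Finset.prod_ite_eq' Finset.univ i, if_pos (Finset.mem_univ i),
      Real.exp_sum]
    rfl
  simp only [h1]
  rw [sum_prod_spin fun j x => (if j = i then x else 1) * Real.exp (h j * x),
    ← Finset.prod_div_distrib, Finset.prod_eq_single i]
  · rw [if_pos rfl, if_pos rfl, Real.tanh_eq_sinh_div_cosh, Real.sinh_eq, Real.cosh_eq]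
    have := Real.exp_pos (h i)
    have := Real.exp_pos (-h i)
    field_simp
    ring_nf
  · intro j _ hj
    rw [if_neg hj, if_neg hj, div_eq_one_iff_eq (by positivity), Real.cosh_eq]
    ring_nf
  · simp

/-- The one-body integral `∫ dγ(z₂) cosh ^ m (u z₁ + w z₂) G(u z₁ + w z₂)`. -/
noncomputable def siteIntegral (m u w : ℝ) (G : ℝ → ℝ) (z₁ : ℝ) : ℝ :=
  ∫ z₂, Real.cosh (u * z₁ + w * z₂) ^ m * G (u * z₁ + w * z₂) ∂(gaussianReal 0 1)

variable {m : ℝ}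

theorem continuous_cosh_rpow : Continuous fun x : ℝ => Real.cosh x ^ m :=
  Real.continuous_cosh.rpow_const fun x => Or.inl (Real.cosh_pos x).ne'

theorem one_le_cosh_rpow (hm₀ : 0 < m) (x : ℝ) : 1 ≤ Real.cosh x ^ m :=
  Real.one_le_rpow (Real.one_le_cosh x) hm₀.le

theorem cosh_rpow_le (hm₁ : m < 1) (x : ℝ) : Real.cosh x ^ m ≤ Real.exp |x| := by
  refine (Real.rpow_le_rpow_of_exponent_le (Real.one_le_cosh x) hm₁.le).trans ?_
  rw [Real.rpow_one, ← Real.cosh_abs, Real.cosh_eq]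
  have := Real.exp_le_exp.2 (show -|x| ≤ |x| by linarith [abs_nonneg x])
  linarith

theorem cosh_affine_rpow_le (hm₁ : m < 1) (u w z₁ z₂ : ℝ) :
    Real.cosh (u * z₁ + w * z₂) ^ m ≤ Real.exp (|u| * |z₁|) * Real.exp (|w| * |z₂|) := by
  refine (cosh_rpow_le hm₁ _).trans ?_
  rw [← Real.exp_add, ← abs_mul, ← abs_mul]
  exact Real.exp_le_exp.2 (abs_add_le _ _)

theorem integrable_site (hm₁ : m < 1) (u w z₁ : ℝ) :
    Integrable (fun z₂ => Real.cosh (u * z₁ + w * z₂) ^ m) (gaussianReal 0 1) := by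
  refine Integrable.mono' ((integrable_exp_abs |w|).const_mul (Real.exp (|u| * |z₁|)))
    (continuous_cosh_rpow.comp (by fun_prop)).aestronglyMeasurable (Eventually.of_forall fun z₂ => ?_)
  rw [Real.norm_eq_abs, abs_of_pos (Real.rpow_pos_of_pos (Real.cosh_pos _) _)]
  exact cosh_affine_rpow_le hm₁ u w z₁ z₂

theorem one_le_siteIntegral (hm₀ : 0 < m) (hm₁ : m < 1) (u w z₁ : ℝ) :
    1 ≤ siteIntegral m u w (fun _ => 1) z₁ := by
  simp only [siteIntegral, mul_one]
  calc (1 : ℝ) = ∫ _, (1 : ℝ) ∂(gaussianReal 0 1) := by simp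
    _ ≤ _ := integral_mono (integrable_const _) (integrable_site hm₁ u w z₁)
      fun z₂ => one_le_cosh_rpow hm₀ _

theorem stronglyMeasurable_siteIntegral (u w : ℝ) {G : ℝ → ℝ} (hG : Continuous G) :
    StronglyMeasurable (siteIntegral m u w G) := by
  unfold siteIntegral
  refine StronglyMeasurable.integral_prod_right (f := fun z₁ z₂ =>
    Real.cosh (u * z₁ + w * z₂) ^ m * G (u * z₁ + w * z₂)) ?_
  have h : Continuous fun z : ℝ × ℝ => u * z.1 + w * z.2 := by fun_prop
  exact ((continuous_cosh_rpow.comp h).mul (hG.comp h)).stronglyMeasurable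

theorem integrable_log_siteIntegral (hm₀ : 0 < m) (hm₁ : m < 1) (u w : ℝ) :
    Integrable (fun z => Real.log (siteIntegral m u w (fun _ => 1) z)) (gaussianReal 0 1) := by
  set C := ∫ z₂, Real.exp (|w| * |z₂|) ∂(gaussianReal 0 1) with hC
  have hC0 : 0 < C := integral_exp_pos (integrable_exp_abs |w|)
  refine Integrable.mono' (g := fun z => |u| * |z| + |Real.log C|) ?_
    (Real.measurable_log.comp
      (stronglyMeasurable_siteIntegral u w continuous_const).measurable).aestronglyMeasurable
    (Eventually.of_forall fun z => ?_)
  · have h : Integrable (fun z : ℝ => z) (gaussianReal 0 1) := (memLp_id_gaussianReal 1).integrable le_rfl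
    exact (h.abs.const_mul _).add (integrable_const _)
  · have h1 := one_le_siteIntegral hm₀ hm₁ u w z
    have h2 : siteIntegral m u w (fun _ => 1) z ≤ Real.exp (|u| * |z|) * C := by
      simp only [siteIntegral, mul_one]
      rw [hC, ← integral_const_mul]
      exact integral_mono (integrable_site hm₁ u w z) ((integrable_exp_abs |w|).const_mul _)
        fun z₂ => cosh_affine_rpow_le hm₁ u w z z₂
    have h3 := Real.log_le_log (by linarith) h2
    rw [Real.log_mul (Real.exp_pos _).ne' hC0.ne', Real.log_exp] at h3
    rw [Real.norm_eq_abs, abs_of_nonneg (Real.log_nonneg h1)]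
    linarith [le_abs_self (Real.log C)]

/-- Without the `p`-spin interaction the energy is that of independent spins in random fields. -/
theorem randomEnergy_add_field (u w : ℝ) (g : Tuples p N ⊕ Fin N → ℝ) (k : Fin N → ℝ) :
    randomEnergy outerObservable (outerAmplitude 0 u) g + randomEnergy spinObservable (fun _ => w) k
      = fun σ => ∑ i, (u * g (Sum.inr i) + w * k i) * spin σ i := by
  funext σ
  simp [randomEnergy, outerObservable, outerAmplitude, spinObservable, add_mul,
    Finset.sum_add_distrib]

/-- One site of a product measure is changed, the others factor out. -/
theorem integral_prod_mul_eval {ι : Type} [Fintype ι] [DecidableEq ι] (a : ι → ℝ → ℝ) (b : ℝ → ℝ)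
    (i : ι) (ha : ∫ x, a i x ∂(gaussianReal 0 1) ≠ 0) :
    ∫ k, (∏ j, a j (k j)) * b (k i) ∂(gaussianFamily ι)
      = (∏ j, ∫ x, a j x ∂(gaussianReal 0 1)) * ((∫ x, a i x * b x ∂(gaussianReal 0 1))
        / ∫ x, a i x ∂(gaussianReal 0 1)) := by
  have h1 : ∀ k : ι → ℝ, (∏ j, a j (k j)) * b (k i)
      = ∏ j, (fun x => a j x * if j = i then b x else 1) (k j) := fun k => by
    simp only [Finset.prod_mul_distrib, Finset.prod_ite_eq', Finset.mem_univ, if_true]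
  simp only [h1]
  rw [gaussianFamily, integral_fintype_prod_eq_prod (μ := fun _ : ι => gaussianReal 0 1)
      (fun j x => a j x * if j = i then b x else 1),
    ← Finset.mul_prod_erase _ _ (Finset.mem_univ i),
    ← Finset.mul_prod_erase _ (fun j => ∫ x, a j x ∂(gaussianReal 0 1)) (Finset.mem_univ i)]
  have h2 : ∀ j ∈ Finset.univ.erase i, ∫ x, a j x * (if j = i then b x else 1) ∂(gaussianReal 0 1)
      = ∫ x, a j x ∂(gaussianReal 0 1) := fun j hj => by
    simp [Finset.ne_of_mem_erase hj]
  rw [Finset.prod_congr rfl h2]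
  simp only [if_true]
  field_simp

theorem integral_two_cosh_rpow (u w z₁ : ℝ) (G : ℝ → ℝ) :
    ∫ z₂, (2 * Real.cosh (u * z₁ + w * z₂)) ^ m * G (u * z₁ + w * z₂) ∂(gaussianReal 0 1)
      = 2 ^ m * siteIntegral m u w G z₁ := by
  rw [siteIntegral, ← integral_const_mul]
  congr 1
  ext z₂
  rw [Real.mul_rpow zero_le_two (Real.cosh_pos _).le]
  ring

theorem tiltedIntegral_one_field (u w : ℝ) (g : Tuples p N ⊕ Fin N → ℝ) :
    tiltedIntegral m spinObservable (fun _ => w) (fun _ => 1)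
        (randomEnergy outerObservable (outerAmplitude 0 u) g)
      = ∏ i, (2 ^ m * siteIntegral m u w (fun _ => 1) (g (Sum.inr i))) := by
  simp only [tiltedIntegral, randomEnergy_add_field, gibbsZ_field, mul_one]
  have h1 : ∀ k : Fin N → ℝ, (∏ i, (2 * Real.cosh (u * g (Sum.inr i) + w * k i))) ^ m
      = ∏ i, (fun x => (2 * Real.cosh (u * g (Sum.inr i) + w * x)) ^ m) (k i) := fun k =>
    (Real.finsetProd_rpow _ _ (fun i _ => by positivity) m).symm
  simp only [h1]
  rw [gaussianFamily, integral_fintype_prod_eq_prod (μ := fun _ : Fin N => gaussianReal 0 1)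
    (fun i x => (2 * Real.cosh (u * g (Sum.inr i) + w * x)) ^ m)]
  refine Finset.prod_congr rfl fun i _ => ?_
  rw [← integral_two_cosh_rpow]
  simp

/-- With independent spins the other sites cancel between numerator and denominator. -/
theorem tiltedMean_field (hm₀ : 0 < m) (hm₁ : m < 1) (u w : ℝ) (g : Tuples p N ⊕ Fin N → ℝ)
    (i : Fin N) (G : ℝ → ℝ) :
    tiltedMean m spinObservable (fun _ => w) (fun v => G (gibbsAvg v (spinObservable i)))
        (randomEnergy outerObservable (outerAmplitude 0 u) g)
      = siteIntegral m u w (fun x => G (Real.tanh x)) (g (Sum.inr i))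
        / siteIntegral m u w (fun _ => 1) (g (Sum.inr i)) := by
  have hpos : ∀ z, 0 < siteIntegral m u w (fun _ => 1) z := fun z =>
    one_pos.trans_le (one_le_siteIntegral hm₀ hm₁ u w z)
  have h2 : (0 : ℝ) < 2 ^ m := Real.rpow_pos_of_pos two_pos m
  have hone : ∀ z, ∫ x, (2 * Real.cosh (u * z + w * x)) ^ m ∂(gaussianReal 0 1)
      = 2 ^ m * siteIntegral m u w (fun _ => 1) z := fun z => by
    rw [← integral_two_cosh_rpow]; simp
  have hprod : (0 : ℝ) < ∏ i, (2 ^ m * siteIntegral m u w (fun _ => 1) (g (Sum.inr i))) :=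
    Finset.prod_pos fun i _ => mul_pos h2 (hpos _)
  rw [tiltedMean, tiltedIntegral_one_field, div_eq_iff hprod.ne']
  simp only [tiltedIntegral, randomEnergy_add_field, gibbsZ_field, gibbsAvg_field]
  have h1 : ∀ k : Fin N → ℝ, (∏ i, (2 * Real.cosh (u * g (Sum.inr i) + w * k i))) ^ m
      = ∏ i, (fun x => (2 * Real.cosh (u * g (Sum.inr i) + w * x)) ^ m) (k i) := fun k =>
    (Real.finsetProd_rpow _ _ (fun i _ => by positivity) m).symm
  simp only [h1]
  rw [integral_prod_mul_eval
    (fun j x => (2 * Real.cosh (u * g (Sum.inr j) + w * x)) ^ m)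
    (fun x => G (Real.tanh (u * g (Sum.inr i) + w * x))) i
    (by rw [hone]; exact (mul_pos h2 (hpos _)).ne')]
  rw [integral_two_cosh_rpow u w (g (Sum.inr i)) fun x => G (Real.tanh x)]
  simp only [hone]
  rw [mul_div_mul_left _ _ h2.ne', mul_comm]

theorem continuous_tanh : Continuous Real.tanh := by
  simp only [funext Real.tanh_eq_sinh_div_cosh]
  exact Real.continuous_sinh.div Real.continuous_cosh fun x => (Real.cosh_pos x).ne'

theorem outerMoment_field (hm₀ : 0 < m) (hm₁ : m < 1) (u w : ℝ) (i : Fin N) :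
    outerMoment m (outerObservable (p := p)) spinObservable (outerAmplitude 0 u) (fun _ => w)
        (spinObservable i)
      = ∫ z, (siteIntegral m u w Real.tanh z / siteIntegral m u w (fun _ => 1) z) ^ 2
        ∂(gaussianReal 0 1) := by
  simp only [outerMoment]
  simp only [tiltedMean_field hm₀ hm₁ u w _ i fun x => x]
  exact integral_comp_eval (μ := fun _ : Tuples p N ⊕ Fin N => gaussianReal 0 1) (i := Sum.inr i)
    (f := fun z => (siteIntegral m u w Real.tanh z / siteIntegral m u w (fun _ => 1) z) ^ 2)
    (((stronglyMeasurable_siteIntegral u w continuous_tanh).measurable.div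
      (stronglyMeasurable_siteIntegral u w continuous_const).measurable).pow_const
        2).aestronglyMeasurable

theorem innerMoment_field (hm₀ : 0 < m) (hm₁ : m < 1) (u w : ℝ) (i : Fin N) :
    innerMoment m (outerObservable (p := p)) spinObservable (outerAmplitude 0 u) (fun _ => w)
        (spinObservable i)
      = ∫ z, siteIntegral m u w (fun x => Real.tanh x ^ 2) z / siteIntegral m u w (fun _ => 1) z
        ∂(gaussianReal 0 1) := by
  simp only [innerMoment]
  simp only [tiltedMean_field hm₀ hm₁ u w _ i fun x => x ^ 2]
  exact integral_comp_eval (μ := fun _ : Tuples p N ⊕ Fin N => gaussianReal 0 1) (i := Sum.inr i)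
    (f := fun z => siteIntegral m u w (fun x => Real.tanh x ^ 2) z
      / siteIntegral m u w (fun _ => 1) z)
    ((stronglyMeasurable_siteIntegral u w (continuous_tanh.pow 2)).measurable.div
      (stronglyMeasurable_siteIntegral u w continuous_const).measurable).aestronglyMeasurable

theorem twoLevelFreeEnergy_field (hm₀ : 0 < m) (hm₁ : m < 1) (u w : ℝ) :
    twoLevelFreeEnergy m (outerObservable (p := p) (N := N)) spinObservable (outerAmplitude 0 u)
        (fun _ => w)
      = N * (Real.log 2 + 1 / m * ∫ z, Real.log (siteIntegral m u w (fun _ => 1) z)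
        ∂(gaussianReal 0 1)) := by
  have hpos : ∀ z, 0 < siteIntegral m u w (fun _ => 1) z := fun z =>
    one_pos.trans_le (one_le_siteIntegral hm₀ hm₁ u w z)
  have h2 : (0 : ℝ) < 2 ^ m := Real.rpow_pos_of_pos two_pos m
  have hlog : ∀ g : Tuples p N ⊕ Fin N → ℝ,
      1 / m * Real.log (∏ i, (2 ^ m * siteIntegral m u w (fun _ => 1) (g (Sum.inr i))))
      = ∑ i, (Real.log 2
        + 1 / m * Real.log (siteIntegral m u w (fun _ => 1) (g (Sum.inr i)))) := fun g => by
    rw [Real.log_prod fun i _ => (mul_pos h2 (hpos _)).ne', Finset.mul_sum]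
    refine Finset.sum_congr rfl fun i _ => ?_
    rw [Real.log_mul h2.ne' (hpos _).ne', Real.log_rpow two_pos]
    field_simp
  have hsite : Integrable (fun z => Real.log 2
      + 1 / m * Real.log (siteIntegral m u w (fun _ => 1) z)) (gaussianReal 0 1) :=
    (integrable_const _).add ((integrable_log_siteIntegral hm₀ hm₁ u w).const_mul _)
  have hint : ∀ i : Fin N, Integrable (fun g : Tuples p N ⊕ Fin N → ℝ => Real.log 2
      + 1 / m * Real.log (siteIntegral m u w (fun _ => 1) (g (Sum.inr i))))
      (gaussianFamily (Tuples p N ⊕ Fin N)) := fun i =>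
    integrable_comp_eval (μ := fun _ : Tuples p N ⊕ Fin N => gaussianReal 0 1) (i := Sum.inr i) hsite
  simp only [twoLevelFreeEnergy, tiltedIntegral_one_field, hlog]
  rw [integral_finsetSum _ fun i _ => hint i]
  have h3 : ∀ i : Fin N, ∫ g : Tuples p N ⊕ Fin N → ℝ, (Real.log 2
      + 1 / m * Real.log (siteIntegral m u w (fun _ => 1) (g (Sum.inr i))))
        ∂(gaussianFamily (Tuples p N ⊕ Fin N))
      = Real.log 2 + 1 / m * ∫ z, Real.log (siteIntegral m u w (fun _ => 1) z)
        ∂(gaussianReal 0 1) := fun i => by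
    refine (integral_comp_eval (μ := fun _ : Tuples p N ⊕ Fin N => gaussianReal 0 1)
      (i := Sum.inr i) hsite.1).trans ?_
    rw [integral_add (integrable_const _)
      ((integrable_log_siteIntegral hm₀ hm₁ u w).const_mul _), integral_const_mul]
    simp
  simp only [h3]
  simp [mul_add]

/-- With no random field, the two-level free energy is that of the `p`-spin glass. -/
theorem twoLevelFreeEnergy_pSpin (hm₀ : 0 < m) (hm₁ : m < 1) (β : ℝ) (hβ : β ≠ 0) (hN : N ≠ 0) :
    twoLevelFreeEnergy m (outerObservable (p := p) (N := N)) spinObservable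
        (outerAmplitude (β * √((p.factorial : ℝ) / (2 * (N : ℝ) ^ (p - 1)))) 0) (fun _ => 0)
      = N * pressure p N β := by
  set s := β * √((p.factorial : ℝ) / (2 * (N : ℝ) ^ (p - 1))) with hs
  have hint := (integrable_log_tiltedIntegral hm₀ hm₁ (ψ := spinObservable (N := N))
    (φ := outerObservable (p := p)) abs_spinObservable_le
    (fun a σ => abs_le_one_of_sq_eq_one (outerObservable_sq a σ)) (outerAmplitude s 0)
    (fun _ => 0)).const_mul (1 / m)
  have h1 : ∀ (J : Tuples p N → ℝ) (J₁ : Fin N → ℝ), 1 / m * Real.log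
      (tiltedIntegral m spinObservable (fun _ => 0) (fun _ => 1)
        (randomEnergy outerObservable (outerAmplitude s 0) (Sum.elim J J₁)))
      = Real.log (partitionFunction β J) := fun J J₁ => by
    have h2 : ∀ k : Fin N → ℝ, randomEnergy outerObservable (outerAmplitude s 0) (Sum.elim J J₁)
        + randomEnergy spinObservable (fun _ => 0) k = fun σ => -β * hamiltonian J σ := fun k => by
      funext σ
      rw [Pi.add_apply, randomEnergy_outer, randomEnergy_spin, hamiltonian, hs]
      ring
    simp only [tiltedIntegral, h2]
    have h3 : gibbsZ (fun σ => -β * hamiltonian J σ) = partitionFunction β J := rfl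
    have h4 : 0 < partitionFunction β J := h3 ▸ gibbsZ_pos _
    simp only [h3, mul_one, integral_const, probReal_univ, one_smul]
    rw [Real.log_rpow h4]
    field_simp
  rw [twoLevelFreeEnergy, integral_outer hint]
  simp only [h1, integral_const, probReal_univ, one_smul, pressure, freeEnergy]
  have : (N : ℝ) ≠ 0 := by exact_mod_cast hN
  field_simp

end OneBody

/-! ### Interpolation along the free motion -/

section Motion

/-- Amplitude at time `0` of the first random field, `u ^ 2 = β ^ 2 (p / 2) Q₁ ^ (p - 1)`. -/
noncomputable def fieldAmplitude₁ (p : ℕ) (β Q₁ : ℝ) : ℝ := β * √((p : ℝ) / 2) * √(Q₁ ^ (p - 1))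

/-- Amplitude at time `0` of the second random field,
`w ^ 2 = β ^ 2 (p / 2) (Q₂ ^ (p - 1) - Q₁ ^ (p - 1))`. -/
noncomputable def fieldAmplitude₂ (p : ℕ) (β Q₁ Q₂ : ℝ) : ℝ :=
  β * √((p : ℝ) / 2) * √(Q₂ ^ (p - 1) - Q₁ ^ (p - 1))

/-- Amplitude at time `β ^ 2` of the couplings `J`. -/
noncomputable def couplingAmplitude (p N : ℕ) (β : ℝ) : ℝ :=
  β * √((p.factorial : ℝ) / (2 * (N : ℝ) ^ (p - 1)))

variable {p N : ℕ} {β m Q₁ Q₂ θ : ℝ}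

theorem fieldAmplitude₁_sq (hQ₁ : 0 ≤ Q₁) :
    fieldAmplitude₁ p β Q₁ ^ 2 = β ^ 2 * ((p : ℝ) / 2 * Q₁ ^ (p - 1)) := by
  rw [fieldAmplitude₁, mul_pow, mul_pow, Real.sq_sqrt (by positivity), Real.sq_sqrt (by positivity),
    mul_assoc]

theorem fieldAmplitude₂_sq (hQ₁ : 0 ≤ Q₁) (hQ₁₂ : Q₁ < Q₂) :
    fieldAmplitude₂ p β Q₁ Q₂ ^ 2
      = β ^ 2 * ((p : ℝ) / 2 * (Q₂ ^ (p - 1) - Q₁ ^ (p - 1))) := by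
  have := pow_le_pow_left₀ hQ₁ hQ₁₂.le (p - 1)
  rw [fieldAmplitude₂, mul_pow, mul_pow, Real.sq_sqrt (by positivity), Real.sq_sqrt (by linarith),
    mul_assoc]

theorem fieldStrength_sq (p : ℕ) {Q : ℝ} (hQ : 0 ≤ Q) :
    fieldStrength p Q ^ 2 = √((p : ℝ) / 2 * Q ^ (p - 2)) := by
  rw [fieldStrength, ← Real.rpow_natCast, ← Real.rpow_mul (by positivity), Real.sqrt_eq_rpow]
  norm_num

theorem couplingAmplitude_eq (hβ : 0 < β) (hsin : 0 ≤ Real.sin θ) :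
    √((β * Real.sin θ) ^ 2 * p.factorial / (2 * (N : ℝ) ^ (p - 1)))
      = couplingAmplitude p N β * Real.sin θ := by
  rw [mul_div_assoc, Real.sqrt_mul (sq_nonneg _), Real.sqrt_sq (by positivity), couplingAmplitude]
  ring

/-- The amplitude `√x` times the field strength of `Q`, read off from its square; the fourth root in
the field strength becomes a square root. -/
theorem sqrt_mul_fieldStrength {x Q a : ℝ} (hQ : 0 ≤ Q) (ha : 0 ≤ a)
    (h : x * √((p : ℝ) / 2 * Q ^ (p - 2)) = a ^ 2) : √x * fieldStrength p Q = a := by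
  have hf : 0 ≤ fieldStrength p Q := by unfold fieldStrength; positivity
  rw [← Real.sqrt_sq hf, ← Real.sqrt_mul' _ (sq_nonneg _), fieldStrength_sq p hQ, h,
    Real.sqrt_sq ha]

theorem path₁_amplitude (hp : 2 ≤ p) (hβ : 0 < β) (hQ₁ : 0 ≤ Q₁) (hcos : 0 ≤ Real.cos θ) :
    √(path₁ p β Q₁ ((β * Real.sin θ) ^ 2)) * fieldStrength p Q₁
      = fieldAmplitude₁ p β Q₁ * Real.cos θ := by
  refine sqrt_mul_fieldStrength hQ₁ (mul_nonneg (by unfold fieldAmplitude₁; positivity) hcos) ?_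
  have hsq : √((p : ℝ) / 2 * Q₁ ^ (p - 2)) ^ 2 = (p : ℝ) / 2 * Q₁ ^ (p - 2) :=
    Real.sq_sqrt (by positivity)
  have hpow : Q₁ ^ (p - 1) = Q₁ ^ (p - 2) * Q₁ := by rw [← pow_succ]; congr 1; omega
  rw [mul_pow (fieldAmplitude₁ p β Q₁), fieldAmplitude₁_sq hQ₁, path₁, velocity₁, Real.cos_sq', hpow]
  linear_combination (β ^ 2 * (1 - Real.sin θ ^ 2) * Q₁) * hsq

theorem path₂_amplitude (hp : 2 ≤ p) (hβ : 0 < β) (hQ₁ : 0 ≤ Q₁) (hQ₁₂ : Q₁ < Q₂)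
    (hcos : 0 ≤ Real.cos θ) :
    √(path₂ p β Q₁ Q₂ ((β * Real.sin θ) ^ 2)) * fieldStrength p Q₂
      = fieldAmplitude₂ p β Q₁ Q₂ * Real.cos θ := by
  have hQ₂ : 0 < Q₂ := hQ₁.trans_lt hQ₁₂
  refine sqrt_mul_fieldStrength hQ₂.le
    (mul_nonneg (by unfold fieldAmplitude₂; positivity) hcos) ?_
  have hA : √((p : ℝ) / 2) ^ 2 = (p : ℝ) / 2 := Real.sq_sqrt (by positivity)
  have hB : √(Q₂ ^ (p - 2)) ^ 2 = Q₂ ^ (p - 2) := Real.sq_sqrt (by positivity)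
  have hB0 : 0 < √(Q₂ ^ (p - 2)) := Real.sqrt_pos.2 (by positivity)
  have hpow : ∀ Q : ℝ, Q ^ (p - 1) = Q ^ (p - 2) * Q := fun Q => by
    rw [← pow_succ]; congr 1; omega
  rw [mul_pow (fieldAmplitude₂ p β Q₁ Q₂), fieldAmplitude₂_sq hQ₁ hQ₁₂, path₂, velocity₂, Real.cos_sq',
    Real.sqrt_mul (by positivity), hpow, hpow, ← hB]
  have h1 : √((p : ℝ) / 2) * (Q₁ ^ (p - 2) / √(Q₂ ^ (p - 2)) * Q₁ - √(Q₂ ^ (p - 2)) * Q₂)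
        * ((β * Real.sin θ) ^ 2 - β ^ 2) * (√((p : ℝ) / 2) * √(Q₂ ^ (p - 2)))
      = √((p : ℝ) / 2) ^ 2 * (Q₁ ^ (p - 2) * Q₁ - √(Q₂ ^ (p - 2)) ^ 2 * Q₂)
        * ((β * Real.sin θ) ^ 2 - β ^ 2) := by
    field_simp
  simp only [Real.sqrt_sq hB0.le]
  rw [h1, hA]
  ring

/-- The two-level free energy per spin along the free motion; the time is `(β sin θ) ^ 2`, so that
all the amplitudes are smooth functions of `θ`, and `θ` runs from `0` to `π / 2`. -/
noncomputable def interpolation (p N : ℕ) (β m Q₁ Q₂ θ : ℝ) : ℝ :=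
  1 / (N : ℝ) * twoLevelFreeEnergy m (outerObservable (p := p) (N := N)) spinObservable
    (outerAmplitude (couplingAmplitude p N β * Real.sin θ) (fieldAmplitude₁ p β Q₁ * Real.cos θ))
    (fun _ => fieldAmplitude₂ p β Q₁ Q₂ * Real.cos θ)

/-- The moment `outerMoment` of `X` along the free motion. -/
noncomputable def motionMoment₁ (p N : ℕ) (β m Q₁ Q₂ θ : ℝ) (X : Config N → ℝ) : ℝ :=
  outerMoment m (outerObservable (p := p) (N := N)) spinObservable
    (outerAmplitude (couplingAmplitude p N β * Real.sin θ) (fieldAmplitude₁ p β Q₁ * Real.cos θ))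
    (fun _ => fieldAmplitude₂ p β Q₁ Q₂ * Real.cos θ) X

/-- The moment `innerMoment` of `X` along the free motion. -/
noncomputable def motionMoment₂ (p N : ℕ) (β m Q₁ Q₂ θ : ℝ) (X : Config N → ℝ) : ℝ :=
  innerMoment m (outerObservable (p := p) (N := N)) spinObservable
    (outerAmplitude (couplingAmplitude p N β * Real.sin θ) (fieldAmplitude₁ p β Q₁ * Real.cos θ))
    (fun _ => fieldAmplitude₂ p β Q₁ Q₂ * Real.cos θ) X

theorem abs_motionMoment₁_le (hm₀ : 0 < m) (hm₁ : m < 1) {X : Config N → ℝ}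
    (hX : ∀ σ, |X σ| ≤ 1) : |motionMoment₁ p N β m Q₁ Q₂ θ X| ≤ 1 := by
  unfold motionMoment₁ outerMoment
  rw [← Real.norm_eq_abs, ← mul_one (1 : ℝ),
    ← probReal_univ (μ := gaussianFamily (Tuples p N ⊕ Fin N))]
  refine norm_integral_le_of_norm_le_const (Eventually.of_forall fun g => ?_)
  rw [probReal_univ, Real.norm_eq_abs, abs_of_nonneg (sq_nonneg _)]
  exact (sq_le_one_iff_abs_le_one _).2 (abs_tiltedMean_le hm₀ hm₁ abs_spinObservable_le _ _
    (continuous_gibbsAvg X) fun v => abs_gibbsAvg_le v hX)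

theorem abs_motionMoment₂_le (hm₀ : 0 < m) (hm₁ : m < 1) {X : Config N → ℝ}
    (hX : ∀ σ, |X σ| ≤ 1) : |motionMoment₂ p N β m Q₁ Q₂ θ X| ≤ 1 := by
  unfold motionMoment₂ innerMoment
  rw [← Real.norm_eq_abs, ← mul_one (1 : ℝ),
    ← probReal_univ (μ := gaussianFamily (Tuples p N ⊕ Fin N))]
  refine norm_integral_le_of_norm_le_const (Eventually.of_forall fun g => ?_)
  rw [probReal_univ]
  exact abs_tiltedMean_le hm₀ hm₁ abs_spinObservable_le _ _
    ((continuous_gibbsAvg X).pow 2) fun v => abs_gibbsAvg_sq_le v hX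

/-- The contribution of the `p`-spin interaction to the derivative of the interpolation. -/
noncomputable def interactionTerm (p N : ℕ) (β m Q₁ Q₂ θ : ℝ) : ℝ :=
  (p.factorial : ℝ) / (N : ℝ) ^ p * ∑ I : Tuples p N,
    (1 - (1 - m) * motionMoment₂ p N β m Q₁ Q₂ θ (outerObservable (Sum.inl I))
      - m * motionMoment₁ p N β m Q₁ Q₂ θ (outerObservable (Sum.inl I)))

/-- The derivative of the interpolation with respect to `sin θ ^ 2 / 2`. -/
noncomputable def interpolationRate (p N : ℕ) (β m Q₁ Q₂ θ : ℝ) : ℝ :=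
  β ^ 2 / 2 * interactionTerm p N β m Q₁ Q₂ θ
    - fieldAmplitude₁ p β Q₁ ^ 2
      * (1 / (N : ℝ) * ∑ i : Fin N, (1 - (1 - m) * motionMoment₂ p N β m Q₁ Q₂ θ (spinObservable i)
        - m * motionMoment₁ p N β m Q₁ Q₂ θ (spinObservable i)))
    - fieldAmplitude₂ p β Q₁ Q₂ ^ 2
      * (1 / (N : ℝ) * ∑ i : Fin N, (1 - (1 - m) * motionMoment₂ p N β m Q₁ Q₂ θ (spinObservable i)))

/-- The factor `1 / N ^ p` in front of the sum over `p`-tuples. -/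
theorem couplingAmplitude_sq (hp : 2 ≤ p) (hN : N ≠ 0) :
    1 / (N : ℝ) * couplingAmplitude p N β ^ 2
      = β ^ 2 / 2 * ((p.factorial : ℝ) / (N : ℝ) ^ p) := by
  have hN' : (N : ℝ) ≠ 0 := by exact_mod_cast hN
  have hpow : (N : ℝ) ^ p = (N : ℝ) ^ (p - 1) * N := by rw [← pow_succ]; congr 1; omega
  rw [couplingAmplitude, mul_pow, Real.sq_sqrt (by positivity), hpow]
  field_simp

theorem hasDerivAt_interpolation (hp : 2 ≤ p) (hN : N ≠ 0) (hm₀ : 0 < m) (hm₁ : m < 1) (θ : ℝ) :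
    HasDerivAt (interpolation p N β m Q₁ Q₂)
      (Real.sin θ * Real.cos θ * interpolationRate p N β m Q₁ Q₂ θ) θ := by
  set s := couplingAmplitude p N β with hs
  set u := fieldAmplitude₁ p β Q₁ with hu
  set w := fieldAmplitude₂ p β Q₁ Q₂ with hw
  have hle : ∀ a x : ℝ, |x| ≤ 1 → |a| ≤ |s| + |u| + |w| → |a * x| ≤ |s| + |u| + |w| := by
    intro a x hx ha
    rw [abs_mul]
    nlinarith [abs_nonneg a, abs_nonneg x]
  have hsK : |s| ≤ |s| + |u| + |w| := by linarith [abs_nonneg u, abs_nonneg w]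
  have huK : |u| ≤ |s| + |u| + |w| := by linarith [abs_nonneg s, abs_nonneg w]
  have hwK : |w| ≤ |s| + |u| + |w| := by linarith [abs_nonneg s, abs_nonneg u]
  have hsin : ∀ x, |-Real.sin x| ≤ 1 := fun x => by rw [abs_neg]; exact Real.abs_sin_le_one x
  have h := hasDerivAt_twoLevelFreeEnergy hm₀ hm₁
    (φ := outerObservable (p := p) (N := N)) (ψ := spinObservable)
    (c := fun y => outerAmplitude (s * Real.sin y) (u * Real.cos y))
    (c' := fun y => outerAmplitude (s * Real.cos y) (u * -Real.sin y))
    (d := fun y _ => w * Real.cos y) (d' := fun y _ => w * -Real.sin y)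
    (K := |s| + |u| + |w|)
    spinObservable_sq outerObservable_sq
    (by
      rintro y (I | i)
      · exact (Real.hasDerivAt_sin y).const_mul s
      · exact (Real.hasDerivAt_cos y).const_mul u)
    (fun y _ => (Real.hasDerivAt_cos y).const_mul w)
    (by
      rintro y (I | i)
      · exact hle s _ (Real.abs_sin_le_one y) hsK
      · exact hle u _ (Real.abs_cos_le_one y) huK)
    (by
      rintro y (I | i)
      · exact hle s _ (Real.abs_cos_le_one y) hsK
      · exact hle u _ (hsin y) huK)
    (fun y _ => hle w _ (Real.abs_cos_le_one y) hwK)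
    (fun y _ => hle w _ (hsin y) hwK) (by positivity) θ
  refine (h.const_mul (1 / (N : ℝ))).congr_deriv ?_
  simp only [Fintype.sum_sum_type]
  change 1 / (N : ℝ) * (∑ I : Tuples p N, s * Real.sin θ * (s * Real.cos θ)
        * (1 - (1 - m) * motionMoment₂ p N β m Q₁ Q₂ θ (outerObservable (Sum.inl I))
          - m * motionMoment₁ p N β m Q₁ Q₂ θ (outerObservable (Sum.inl I)))
      + ∑ i : Fin N, u * Real.cos θ * (u * -Real.sin θ)
        * (1 - (1 - m) * motionMoment₂ p N β m Q₁ Q₂ θ (spinObservable i)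
          - m * motionMoment₁ p N β m Q₁ Q₂ θ (spinObservable i))
      + ∑ i : Fin N, w * Real.cos θ * (w * -Real.sin θ)
        * (1 - (1 - m) * motionMoment₂ p N β m Q₁ Q₂ θ (spinObservable i))) = _
  simp only [← Finset.mul_sum]
  rw [interpolationRate, interactionTerm, ← hu, ← hw]
  have hsq := couplingAmplitude_sq (β := β) hp hN
  rw [← hs] at hsq
  linear_combination (Real.sin θ * Real.cos θ * ∑ I : Tuples p N,
    (1 - (1 - m) * motionMoment₂ p N β m Q₁ Q₂ θ (outerObservable (Sum.inl I))
      - m * motionMoment₁ p N β m Q₁ Q₂ θ (outerObservable (Sum.inl I)))) * hsq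

theorem factorial_mul_card_tuples (p N : ℕ) :
    (p.factorial : ℝ) * Fintype.card (Tuples p N) = N.descFactorial p := by
  have h : Fintype.card (Tuples p N) = N.choose p := by
    rw [Fintype.card_finset_len, Fintype.card_fin]
  rw [h, Nat.descFactorial_eq_factorial_mul_choose]
  push_cast
  ring

theorem descFactorial_div_pow_le_one (hN : N ≠ 0) : (N.descFactorial p : ℝ) / (N : ℝ) ^ p ≤ 1 := by
  have : (0 : ℝ) < N := by exact_mod_cast Nat.pos_of_ne_zero hN
  rw [div_le_one (by positivity)]
  exact_mod_cast Nat.descFactorial_le_pow N p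

theorem abs_interpolationRate_le (hN : N ≠ 0) (hm₀ : 0 < m) (hm₁ : m < 1) :
    |interpolationRate p N β m Q₁ Q₂ θ|
      ≤ β ^ 2 / 2 * 2 + fieldAmplitude₁ p β Q₁ ^ 2 * 2 + fieldAmplitude₂ p β Q₁ Q₂ ^ 2 * 2 := by
  have hN' : (0 : ℝ) < N := by exact_mod_cast Nat.pos_of_ne_zero hN
  have hb : ∀ {X : Config N → ℝ}, (∀ σ, |X σ| ≤ 1) →
      |1 - (1 - m) * motionMoment₂ p N β m Q₁ Q₂ θ X - m * motionMoment₁ p N β m Q₁ Q₂ θ X| ≤ 2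
      ∧ |1 - (1 - m) * motionMoment₂ p N β m Q₁ Q₂ θ X| ≤ 2 := by
    intro X hX
    have h1 := abs_le.1 (abs_motionMoment₁_le (p := p) (β := β) (Q₁ := Q₁) (Q₂ := Q₂) (θ := θ)
      hm₀ hm₁ hX)
    have h2 := abs_le.1 (abs_motionMoment₂_le (p := p) (β := β) (Q₁ := Q₁) (Q₂ := Q₂) (θ := θ)
      hm₀ hm₁ hX)
    constructor <;> rw [abs_le] <;> constructor <;> nlinarith
  have hsum : ∀ {ι : Type} [Fintype ι] (f : ι → ℝ), (∀ i, |f i| ≤ 2) →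
      |∑ i, f i| ≤ Fintype.card ι * 2 := by
    intro ι _ f hf
    refine (Finset.abs_sum_le_sum_abs _ _).trans
      ((Finset.sum_le_card_nsmul _ _ 2 fun i _ => hf i).trans_eq ?_)
    rw [nsmul_eq_mul, Finset.card_univ]
  have hout : ∀ (I : Tuples p N) σ, |outerObservable (Sum.inl I) σ| ≤ 1 := fun I σ =>
    abs_le_one_of_sq_eq_one (outerObservable_sq _ σ)
  have hT : |interactionTerm p N β m Q₁ Q₂ θ| ≤ 2 := by
    rw [interactionTerm, abs_mul, abs_of_nonneg (by positivity)]
    refine (mul_le_mul_of_nonneg_left (hsum _ fun I => (hb (hout I)).1) (by positivity)).trans ?_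
    have h1 := descFactorial_div_pow_le_one (p := p) hN
    rw [← factorial_mul_card_tuples] at h1
    calc _ = (p.factorial : ℝ) * Fintype.card (Tuples p N) / (N : ℝ) ^ p * 2 := by ring
      _ ≤ 1 * 2 := by gcongr
      _ = 2 := one_mul 2
  have hav : ∀ f : Fin N → ℝ, (∀ i, |f i| ≤ 2) → |1 / (N : ℝ) * ∑ i, f i| ≤ 2 := fun f hf => by
    rw [abs_mul, abs_of_nonneg (by positivity), one_div_mul_eq_div, div_le_iff₀ hN', mul_comm 2]
    simpa using hsum f hf
  rw [interpolationRate]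
  refine (abs_sub _ _).trans (add_le_add ((abs_sub _ _).trans (add_le_add ?_ ?_)) ?_)
  · rw [abs_mul, abs_of_nonneg (by positivity)]
    gcongr
  · rw [abs_mul, abs_of_nonneg (by positivity)]
    gcongr
    exact hav _ fun i => (hb (abs_spinObservable_le i)).1
  · rw [abs_mul, abs_of_nonneg (by positivity)]
    gcongr
    exact hav _ fun i => (hb (abs_spinObservable_le i)).2

end Motion

/-! ### The thermodynamic limit -/

section Limit

variable {p N : ℕ} {β m Q₁ Q₂ θ : ℝ}

/-- The average `⟨·⟩₁` along the free motion of a kernel `r ∑_j X_j(σ) X_j(σ')`. -/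
theorem bracket₁_motion (hp : 2 ≤ p) (hβ : 0 < β) (hm₀ : 0 < m) (hm₁ : m < 1) (hQ₁ : 0 ≤ Q₁)
    (hQ₁₂ : Q₁ < Q₂) (hsin : 0 ≤ Real.sin θ) (hcos : 0 ≤ Real.cos θ)
    {ι : Type} [Fintype ι] (r : ℝ) (X : ι → Config N → ℝ) (hX : ∀ j σ, |X j σ| ≤ 1) :
    bracket₁ p N m Q₁ Q₂ ((β * Real.sin θ) ^ 2) (path₁ p β Q₁ ((β * Real.sin θ) ^ 2))
        (path₂ p β Q₁ Q₂ ((β * Real.sin θ) ^ 2)) (fun σ σ' => r * ∑ j, X j σ * X j σ')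
      = r * ∑ j, motionMoment₁ p N β m Q₁ Q₂ θ (X j) :=
  bracket₁_sum hm₀ hm₁ (couplingAmplitude_eq hβ hsin) (path₁_amplitude hp hβ hQ₁ hcos)
    (path₂_amplitude hp hβ hQ₁ hQ₁₂ hcos) r X hX

/-- The average `⟨·⟩₂` along the free motion of a kernel `r ∑_j X_j(σ) X_j(σ')`. -/
theorem bracket₂_motion (hp : 2 ≤ p) (hβ : 0 < β) (hm₀ : 0 < m) (hm₁ : m < 1) (hQ₁ : 0 ≤ Q₁)
    (hQ₁₂ : Q₁ < Q₂) (hsin : 0 ≤ Real.sin θ) (hcos : 0 ≤ Real.cos θ)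
    {ι : Type} [Fintype ι] (r : ℝ) (X : ι → Config N → ℝ) (hX : ∀ j σ, |X j σ| ≤ 1) :
    bracket₂ p N m Q₁ Q₂ ((β * Real.sin θ) ^ 2) (path₁ p β Q₁ ((β * Real.sin θ) ^ 2))
        (path₂ p β Q₁ Q₂ ((β * Real.sin θ) ^ 2)) (fun σ σ' => r * ∑ j, X j σ * X j σ')
      = r * ∑ j, motionMoment₂ p N β m Q₁ Q₂ θ (X j) :=
  bracket₂_sum hm₀ hm₁ (couplingAmplitude_eq hβ hsin) (path₁_amplitude hp hβ hQ₁ hcos)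
    (path₂_amplitude hp hβ hQ₁ hQ₁₂ hcos) r X hX

/-- Along the free motion, the interaction term converges to `1 - m Q₁ ^ p - (1 - m) Q₂ ^ p`: this
is where the vanishing of the potential is used. -/
theorem tendsto_interactionTerm (hp : 2 ≤ p) (hβ : 0 < β) (hm₀ : 0 < m) (hm₁ : m < 1)
    (hQ₁ : 0 ≤ Q₁) (hQ₁₂ : Q₁ < Q₂) (hV : VanishingPotential p β m Q₁ Q₂)
    (hsin : 0 ≤ Real.sin θ) (hcos : 0 < Real.cos θ) :
    Tendsto (fun N => interactionTerm p N β m Q₁ Q₂ θ) atTop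
      (𝓝 (1 - m * Q₁ ^ p - (1 - m) * Q₂ ^ p)) := by
  have ht : (β * Real.sin θ) ^ 2 < β ^ 2 := by
    have := Real.sin_sq_add_cos_sq θ
    have h2 : 0 < β ^ 2 * Real.cos θ ^ 2 := by positivity
    nlinarith
  obtain ⟨hq₁, hq₂, hpot⟩ := hV _ (sq_nonneg (β * Real.sin θ)) ht
  set t := (β * Real.sin θ) ^ 2
  set B₁ := fun N : ℕ => bracket₁ p N m Q₁ Q₂ t (path₁ p β Q₁ t) (path₂ p β Q₁ Q₂ t)
    fun σ σ' => overlap σ σ' ^ p with hB₁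
  set B₂ := fun N : ℕ => bracket₂ p N m Q₁ Q₂ t (path₁ p β Q₁ t) (path₂ p β Q₁ Q₂ t)
    fun σ σ' => overlap σ σ' ^ p with hB₂
  have hpow : ∀ Q : ℝ, Q ^ p = Q ^ 2 * Q ^ (p - 2) := fun Q => by rw [← pow_add]; congr 1; omega
  -- the limit of the moments of order `p` follows from that of the potential
  have hB : Tendsto (fun N => m * B₁ N + (1 - m) * B₂ N) atTop
      (𝓝 (m * Q₁ ^ p + (1 - m) * Q₂ ^ p)) := by
    have h1 := (((hq₁.pow 2).mul_const (Q₁ ^ (p - 2))).const_sub (Q₁ ^ p)).const_mul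
      (m * ((p : ℝ) / 2))
    have h2 := (((hq₂.pow 2).mul_const (Q₂ ^ (p - 2))).const_sub (Q₂ ^ p)).const_mul
      ((1 - m) * ((p : ℝ) / 2))
    have h3 := (((hpot.const_mul 2).sub h1).sub h2).add_const (m * Q₁ ^ p + (1 - m) * Q₂ ^ p)
    rw [← hpow, ← hpow, sub_self, sub_self, mul_zero, mul_zero, mul_zero, sub_zero, sub_zero,
      zero_add] at h3
    refine h3.congr fun N => ?_
    simp only [potential, hB₁, hB₂]
    ring
  have hD := tendsto_descFactorial_div_pow p
  have hkey : Tendsto (fun N => interactionTerm p N β m Q₁ Q₂ θ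
      - ((N.descFactorial p : ℝ) / (N : ℝ) ^ p - (m * B₁ N + (1 - m) * B₂ N))) atTop (𝓝 0) := by
    have hz : Tendsto (fun N : ℕ => 1 - (N.descFactorial p : ℝ) / (N : ℝ) ^ p) atTop (𝓝 0) := by
      simpa using hD.const_sub 1
    refine squeeze_zero_norm' ?_ hz
    filter_upwards [eventually_ne_atTop 0] with N hN
    have hN' : (0 : ℝ) < (N : ℝ) ^ p := pow_pos (by exact_mod_cast Nat.pos_of_ne_zero hN) p
    have e1 : B₁ N = 1 / (N : ℝ) ^ p
        * ∑ f : Fin p → Fin N, motionMoment₁ p N β m Q₁ Q₂ θ (spinProduct f) := by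
      simp only [hB₁, overlap_pow]
      exact bracket₁_motion hp hβ hm₀ hm₁ hQ₁ hQ₁₂ hsin hcos.le _ _ abs_spinProduct_le
    have e2 : B₂ N = 1 / (N : ℝ) ^ p
        * ∑ f : Fin p → Fin N, motionMoment₂ p N β m Q₁ Q₂ θ (spinProduct f) := by
      simp only [hB₂, overlap_pow]
      exact bracket₂_motion hp hβ hm₀ hm₁ hQ₁ hQ₁₂ hsin hcos.le _ _ abs_spinProduct_le
    have b1 := abs_sum_spinProduct_sub_le (p := p) (motionMoment₁ p N β m Q₁ Q₂ θ)
      fun f => abs_motionMoment₁_le hm₀ hm₁ (abs_spinProduct_le f)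
    have b2 := abs_sum_spinProduct_sub_le (p := p) (motionMoment₂ p N β m Q₁ Q₂ θ)
      fun f => abs_motionMoment₂_le hm₀ hm₁ (abs_spinProduct_le f)
    set S₁ := ∑ f : Fin p → Fin N, motionMoment₁ p N β m Q₁ Q₂ θ (spinProduct f)
    set S₂ := ∑ f : Fin p → Fin N, motionMoment₂ p N β m Q₁ Q₂ θ (spinProduct f)
    set T₁ := ∑ I : Tuples p N, motionMoment₁ p N β m Q₁ Q₂ θ (outerObservable (Sum.inl I))
      with hT₁
    set T₂ := ∑ I : Tuples p N, motionMoment₂ p N β m Q₁ Q₂ θ (outerObservable (Sum.inl I))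
      with hT₂
    have e3 : interactionTerm p N β m Q₁ Q₂ θ = ((N.descFactorial p : ℝ)
        - (1 - m) * (p.factorial * T₂) - m * (p.factorial * T₁)) / (N : ℝ) ^ p := by
      rw [interactionTerm, Finset.sum_sub_distrib, Finset.sum_sub_distrib, ← Finset.mul_sum,
        ← Finset.mul_sum, ← factorial_mul_card_tuples, hT₁, hT₂, Finset.sum_const,
        Finset.card_univ, nsmul_eq_mul]
      ring
    have e4 : interactionTerm p N β m Q₁ Q₂ θ
        - ((N.descFactorial p : ℝ) / (N : ℝ) ^ p - (m * B₁ N + (1 - m) * B₂ N))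
        = (m * (S₁ - p.factorial * T₁) + (1 - m) * (S₂ - p.factorial * T₂)) / (N : ℝ) ^ p := by
      rw [e1, e2, e3]
      ring
    have e5 : 1 - (N.descFactorial p : ℝ) / (N : ℝ) ^ p
        = ((N : ℝ) ^ p - N.descFactorial p) / (N : ℝ) ^ p := by
      rw [sub_div, div_self hN'.ne']
    rw [Real.norm_eq_abs, e4, e5, abs_div, abs_of_pos hN']
    refine div_le_div_of_nonneg_right ?_ hN'.le
    rw [abs_le] at b1 b2 ⊢
    constructor <;> nlinarith
  have h := hkey.add (hD.sub hB)
  simp only [sub_add_cancel, zero_add] at h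
  convert h using 2
  ring

/-- The limit of the derivative of the interpolation along the free motion. -/
theorem tendsto_interpolationRate (hp : 2 ≤ p) (hβ : 0 < β) (hm₀ : 0 < m) (hm₁ : m < 1)
    (hQ₁ : 0 ≤ Q₁) (hQ₁₂ : Q₁ < Q₂) (hV : VanishingPotential p β m Q₁ Q₂)
    (hsin : 0 ≤ Real.sin θ) (hcos : 0 < Real.cos θ) :
    Tendsto (fun N => interpolationRate p N β m Q₁ Q₂ θ) atTop
      (𝓝 (β ^ 2 / 2 * (1 + ((p : ℝ) - 1) * m * Q₁ ^ p + ((p : ℝ) - 1) * (1 - m) * Q₂ ^ p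
        - p * Q₂ ^ (p - 1)))) := by
  have ht : (β * Real.sin θ) ^ 2 < β ^ 2 := by
    have := Real.sin_sq_add_cos_sq θ
    have h2 : 0 < β ^ 2 * Real.cos θ ^ 2 := by positivity
    nlinarith
  obtain ⟨hq₁, hq₂, -⟩ := hV _ (sq_nonneg (β * Real.sin θ)) ht
  have hT := tendsto_interactionTerm hp hβ hm₀ hm₁ hQ₁ hQ₁₂ hV hsin hcos
  have h := ((hT.const_mul (β ^ 2 / 2)).sub
    (((hq₂.const_mul (1 - m)).const_sub 1 |>.sub (hq₁.const_mul m)).const_mul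
      (fieldAmplitude₁ p β Q₁ ^ 2))).sub
    (((hq₂.const_mul (1 - m)).const_sub 1).const_mul (fieldAmplitude₂ p β Q₁ Q₂ ^ 2))
  have hpow : ∀ Q : ℝ, Q ^ p = Q ^ (p - 1) * Q := fun Q => by rw [← pow_succ]; congr 1; omega
  have hlim : β ^ 2 / 2 * (1 + ((p : ℝ) - 1) * m * Q₁ ^ p + ((p : ℝ) - 1) * (1 - m) * Q₂ ^ p
        - p * Q₂ ^ (p - 1))
      = β ^ 2 / 2 * (1 - m * Q₁ ^ p - (1 - m) * Q₂ ^ p)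
        - fieldAmplitude₁ p β Q₁ ^ 2 * (1 - (1 - m) * Q₂ - m * Q₁)
        - fieldAmplitude₂ p β Q₁ Q₂ ^ 2 * (1 - (1 - m) * Q₂) := by
    rw [fieldAmplitude₁_sq hQ₁, fieldAmplitude₂_sq hQ₁ hQ₁₂, hpow, hpow]
    ring
  rw [hlim]
  refine h.congr' ?_
  filter_upwards [eventually_ne_atTop 0] with N hN
  have hN' : (N : ℝ) ≠ 0 := by exact_mod_cast hN
  have e1 : meanOverlap₁ p N m Q₁ Q₂ ((β * Real.sin θ) ^ 2)
      (path₁ p β Q₁ ((β * Real.sin θ) ^ 2)) (path₂ p β Q₁ Q₂ ((β * Real.sin θ) ^ 2))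
      = 1 / (N : ℝ) * ∑ i : Fin N, motionMoment₁ p N β m Q₁ Q₂ θ (spinObservable i) :=
    bracket₁_motion hp hβ hm₀ hm₁ hQ₁ hQ₁₂ hsin hcos.le _ _ abs_spinObservable_le
  have e2 : meanOverlap₂ p N m Q₁ Q₂ ((β * Real.sin θ) ^ 2)
      (path₁ p β Q₁ ((β * Real.sin θ) ^ 2)) (path₂ p β Q₁ Q₂ ((β * Real.sin θ) ^ 2))
      = 1 / (N : ℝ) * ∑ i : Fin N, motionMoment₂ p N β m Q₁ Q₂ θ (spinObservable i) :=
    bracket₂_motion hp hβ hm₀ hm₁ hQ₁ hQ₁₂ hsin hcos.le _ _ abs_spinObservable_le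
  rw [e1, e2, interpolationRate]
  simp only [Finset.sum_sub_distrib, ← Finset.mul_sum, Finset.sum_const, Finset.card_univ,
    Fintype.card_fin, nsmul_eq_mul]
  field_simp

/-- The starting point: independent spins in random fields. -/
theorem interpolation_zero (hN : N ≠ 0) (hm₀ : 0 < m) (hm₁ : m < 1) :
    interpolation p N β m Q₁ Q₂ 0 = Real.log 2 + 1 / m * ∫ z₁, Real.log
      (∫ z₂, Real.cosh (theta p β Q₁ Q₂ z₁ z₂) ^ m ∂(gaussianReal 0 1)) ∂(gaussianReal 0 1) := by
  have hN' : (N : ℝ) ≠ 0 := by exact_mod_cast hN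
  rw [interpolation, Real.sin_zero, Real.cos_zero, mul_zero, mul_one, mul_one,
    twoLevelFreeEnergy_field hm₀ hm₁, ← mul_assoc, one_div_mul_cancel hN', one_mul]
  have hθ : ∀ z₁ z₂, fieldAmplitude₁ p β Q₁ * z₁ + fieldAmplitude₂ p β Q₁ Q₂ * z₂
      = theta p β Q₁ Q₂ z₁ z₂ := fun z₁ z₂ => by
    rw [fieldAmplitude₁, fieldAmplitude₂, theta]; ring
  simp only [siteIntegral, hθ, mul_one]

/-- The arrival point: the `p`-spin glass without random fields. -/
theorem interpolation_pi_div_two (hN : N ≠ 0) (hβ : 0 < β) (hm₀ : 0 < m) (hm₁ : m < 1) :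
    interpolation p N β m Q₁ Q₂ (Real.pi / 2) = pressure p N β := by
  have hN' : (N : ℝ) ≠ 0 := by exact_mod_cast hN
  rw [interpolation, Real.sin_pi_div_two, Real.cos_pi_div_two, mul_zero, mul_zero, mul_one,
    couplingAmplitude, twoLevelFreeEnergy_pSpin hm₀ hm₁ β hβ.ne' hN, ← mul_assoc,
    one_div_mul_cancel hN', one_mul]

theorem tendsto_pressure (hp : 2 ≤ p) (hβ : 0 < β) (hm₀ : 0 < m) (hm₁ : m < 1)
    (hQ₁ : 0 ≤ Q₁) (hQ₁₂ : Q₁ < Q₂) (hV : VanishingPotential p β m Q₁ Q₂) :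
    Tendsto (fun N => pressure p N β) atTop (𝓝 (rsbPressure p β m Q₁ Q₂)) := by
  set L := β ^ 2 / 2 * (1 + ((p : ℝ) - 1) * m * Q₁ ^ p + ((p : ℝ) - 1) * (1 - m) * Q₂ ^ p
        - p * Q₂ ^ (p - 1)) with hL
  set C := β ^ 2 / 2 * 2 + fieldAmplitude₁ p β Q₁ ^ 2 * 2 + fieldAmplitude₂ p β Q₁ Q₂ ^ 2 * 2
    with hC
  have hC0 : 0 ≤ C := by positivity
  have hmeas : ∀ {N : ℕ}, N ≠ 0 →
      Measurable fun θ => Real.sin θ * Real.cos θ * interpolationRate p N β m Q₁ Q₂ θ := by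
    intro N hN
    -- no regularity of the moments in `θ` is needed: a derivative is measurable
    have : (fun θ => Real.sin θ * Real.cos θ * interpolationRate p N β m Q₁ Q₂ θ)
        = deriv (interpolation p N β m Q₁ Q₂) := by
      funext θ
      exact (hasDerivAt_interpolation hp hN hm₀ hm₁ θ).deriv.symm
    rw [this]
    exact measurable_deriv _
  have hbound : ∀ {N : ℕ}, N ≠ 0 → ∀ θ,
      ‖Real.sin θ * Real.cos θ * interpolationRate p N β m Q₁ Q₂ θ‖ ≤ C := by
    intro N hN θ
    rw [Real.norm_eq_abs, abs_mul, abs_mul]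
    have h1 : |Real.sin θ| * |Real.cos θ| ≤ 1 :=
      mul_le_one₀ (Real.abs_sin_le_one θ) (abs_nonneg _) (Real.abs_cos_le_one θ)
    exact (mul_le_mul h1 (abs_interpolationRate_le hN hm₀ hm₁) (abs_nonneg _)
      zero_le_one).trans_eq (one_mul C)
  have hftc : ∀ {N : ℕ}, N ≠ 0 → ∫ θ in (0 : ℝ)..Real.pi / 2,
      Real.sin θ * Real.cos θ * interpolationRate p N β m Q₁ Q₂ θ
      = pressure p N β - (Real.log 2 + 1 / m * ∫ z₁, Real.log
      (∫ z₂, Real.cosh (theta p β Q₁ Q₂ z₁ z₂) ^ m ∂(gaussianReal 0 1)) ∂(gaussianReal 0 1)) := by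
    intro N hN
    rw [intervalIntegral.integral_eq_sub_of_hasDerivAt
      (fun θ _ => hasDerivAt_interpolation hp hN hm₀ hm₁ θ), interpolation_zero hN hm₀ hm₁,
      interpolation_pi_div_two hN hβ hm₀ hm₁]
    refine (intervalIntegrable_const (c := C)).mono_fun
      (hmeas hN).aestronglyMeasurable (Eventually.of_forall fun θ => ?_)
    rw [Real.norm_eq_abs C, abs_of_nonneg hC0]
    exact hbound hN θ
  have hlim : Tendsto (fun N : ℕ => ∫ θ in (0 : ℝ)..Real.pi / 2,
      Real.sin θ * Real.cos θ * interpolationRate p N β m Q₁ Q₂ θ) atTop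
      (𝓝 (∫ θ in (0 : ℝ)..Real.pi / 2, Real.sin θ * Real.cos θ * L)) := by
    refine intervalIntegral.tendsto_integral_filter_of_dominated_convergence (fun _ => C)
      ?_ ?_ intervalIntegrable_const (Eventually.of_forall fun θ hθ => ?_)
    · filter_upwards [eventually_ne_atTop 0] with N hN using (hmeas hN).aestronglyMeasurable
    · filter_upwards [eventually_ne_atTop 0] with N hN using
        Eventually.of_forall fun θ _ => hbound hN θ
    · rw [Set.uIoc_of_le (by positivity)] at hθ
      -- at the arrival point, excluded from the hypothesis, the factor `cos θ` vanishes
      rcases hθ.2.eq_or_lt with h | h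
      · simp [h]
      · exact (tendsto_interpolationRate hp hβ hm₀ hm₁ hQ₁ hQ₁₂ hV
          (Real.sin_nonneg_of_nonneg_of_le_pi hθ.1.le (by linarith [Real.pi_pos]))
          (Real.cos_pos_of_mem_Ioo ⟨by linarith [hθ.1, Real.pi_pos], h⟩)).const_mul _
  rw [intervalIntegral.integral_mul_const, integral_sin_mul_cos₁, Real.sin_pi_div_two,
    Real.sin_zero] at hlim
  have h := hlim.add_const (Real.log 2 + 1 / m * ∫ z₁, Real.log
      (∫ z₂, Real.cosh (theta p β Q₁ Q₂ z₁ z₂) ^ m ∂(gaussianReal 0 1)) ∂(gaussianReal 0 1))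
  have hval : rsbPressure p β m Q₁ Q₂ = (1 ^ 2 - 0 ^ 2) / 2 * L + (Real.log 2
      + 1 / m * ∫ z₁, Real.log (∫ z₂, Real.cosh (theta p β Q₁ Q₂ z₁ z₂) ^ m
        ∂(gaussianReal 0 1)) ∂(gaussianReal 0 1)) := by
    rw [rsbPressure, hL]; ring
  rw [hval]
  refine h.congr' ?_
  filter_upwards [eventually_ne_atTop 0] with N hN
  rw [hftc hN, sub_add_cancel]

/-- At the starting point the spins are independent and the mean overlaps do not depend on `N`, so
that their limits are their values. -/
theorem selfConsistency (hp : 2 ≤ p) (hβ : 0 < β) (hm₀ : 0 < m) (hm₁ : m < 1)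
    (hQ₁ : 0 ≤ Q₁) (hQ₁₂ : Q₁ < Q₂) (hV : VanishingPotential p β m Q₁ Q₂) :
    Q₁ = selfConsistency₁ p β m Q₁ Q₂ ∧ Q₂ = selfConsistency₂ p β m Q₁ Q₂ := by
  have ht : (β * Real.sin 0) ^ 2 = 0 := by simp
  obtain ⟨hq₁, hq₂, -⟩ := hV _ (sq_nonneg (β * Real.sin 0)) (by rw [ht]; positivity)
  have hθ : ∀ z₁ z₂, fieldAmplitude₁ p β Q₁ * z₁ + fieldAmplitude₂ p β Q₁ Q₂ * z₂
      = theta p β Q₁ Q₂ z₁ z₂ := fun z₁ z₂ => by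
    rw [fieldAmplitude₁, fieldAmplitude₂, theta]; ring
  have hsin : 0 ≤ Real.sin 0 := Real.sin_zero.ge
  have hcos : 0 ≤ Real.cos 0 := by simp
  constructor
  · refine tendsto_nhds_unique hq₁ (tendsto_const_nhds.congr' ?_)
    filter_upwards [eventually_ne_atTop 0] with N hN
    have hN' : (N : ℝ) ≠ 0 := by exact_mod_cast hN
    refine Eq.symm ((bracket₁_motion hp hβ hm₀ hm₁ hQ₁ hQ₁₂ hsin hcos _ _
      abs_spinObservable_le).trans ?_)
    simp only [motionMoment₁, Real.sin_zero, Real.cos_zero, mul_zero, mul_one,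
      outerMoment_field hm₀ hm₁, siteIntegral, hθ, Finset.sum_const, Finset.card_univ,
      Fintype.card_fin, nsmul_eq_mul]
    rw [← mul_assoc, one_div_mul_cancel hN', one_mul, selfConsistency₁]
  · refine tendsto_nhds_unique hq₂ (tendsto_const_nhds.congr' ?_)
    filter_upwards [eventually_ne_atTop 0] with N hN
    have hN' : (N : ℝ) ≠ 0 := by exact_mod_cast hN
    refine Eq.symm ((bracket₂_motion hp hβ hm₀ hm₁ hQ₁ hQ₁₂ hsin hcos _ _
      abs_spinObservable_le).trans ?_)
    simp only [motionMoment₂, Real.sin_zero, Real.cos_zero, mul_zero, mul_one,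
      innerMoment_field hm₀ hm₁, siteIntegral, hθ, Finset.sum_const, Finset.card_univ,
      Fintype.card_fin, nsmul_eq_mul]
    rw [← mul_assoc, one_div_mul_cancel hN', one_mul, selfConsistency₂]

end Limit
end PSpin

theorem mainTheorem3 (p : ℕ) (hp : 2 ≤ p) (hp_even : Even p)
    (β m Q₁ Q₂ : ℝ) (hβ : 0 < β) (hm₀ : 0 < m) (hm₁ : m < 1)
    (hQ₁ : 0 ≤ Q₁) (hQ₁₂ : Q₁ < Q₂) (hQ₂ : Q₂ < 1)
    (hV : PSpin.VanishingPotential p β m Q₁ Q₂) :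
    Filter.Tendsto (fun N : ℕ => PSpin.pressure p N β) Filter.atTop
        (nhds (PSpin.rsbPressure p β m Q₁ Q₂)) ∧
      Q₁ = PSpin.selfConsistency₁ p β m Q₁ Q₂ ∧
      Q₂ = PSpin.selfConsistency₂ p β m Q₁ Q₂ :=
  ⟨PSpin.tendsto_pressure hp hβ hm₀ hm₁ hQ₁ hQ₁₂ hV,
    PSpin.selfConsistency hp hβ hm₀ hm₁ hQ₁ hQ₁₂ hV⟩
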